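/- Let $d_A \ge d_B \ge 2$. A state on $\mathbb C^{d_A}\otimes\mathbb C^{d_B}$ is a positive semidefinite $\gamma\in M_{d_A}\otimes M_{d_B}$ of trace one; $\gamma_A=\mathrm{Tr}_B\,\gamma$; $\gamma$ is separable if it is a convex combination of product states $\rho\otimes\sigma$, and entangled otherwise. Then a state of rank at most $d_A$ is almost surely entangled, in the following sense. (i) Parameters for $\gamma_A=\frac1{d_A}I$. For $u,v\in[0,\frac\pi2]$ let $\Phi_{u,v}:M_2\to M_2$ be the linear map $w_0I+\sum_k w_k\sigma_k\mapsto w_0I+\cos u\,w_1\sigma_1+\cos v\,w_2\sigma_2+(\sin u\sin v\,w_0+\cos u\cos v\,w_3)\sigma_3$ ($\sigma_k$ the Pauli matrices) and $Q_{u,v}=\sum_{j,k\le 2}|e_j\rangle\langle e_k|\otimes\Phi_{u,v}(|e_j\rangle\langle e_k|)$. For $Q\in M_2\otimes M_2$, a $d_B\times 2$ matrix $V$ with $V^\dagger V=I_2$, a unitary $U\in M_{d_A}$ and unit vectors $\psi_3,\dots,\psi_{d_A}\in\mathbb C^{d_B}$, put $$G(Q,V,U,\psi)=\tfrac1{d_A}(U\otimes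 I)\Big[(\iota\otimes V)Q(\iota\otimes V)^\dagger+\sum_{k=3}^{d_A}|e_k\rangle\langle e_k|\otimes|\psi_k\rangle\langle\psi_k|\Big](U\otimes I)^\dagger ,$$ where $\iota:\mathbb C^2\to\mathbb C^{d_A}$ is the inclusion on the first two basis vectors. Let $\mu$ be the push-forward under $((u,v),V,U,\psi)\mapsto G(Q_{u,v},V,U,\psi)$ of the product of normalized Lebesgue measure on $[0,\frac\pi2]^2$, an $SU(d_B)$-left-invariant probability measure on the set of such $V$, normalized Haar measure on $SU(d_A)$, and $d_A-2$ copies of a probability measure on the unit sphere of $\mathbb C^{d_B}$. Let $\mathcal Y$ be the set of all $G(Q,V,U,\psi)$ with $U$ unitary, $Q\ge 0$, $\mathrm{rank}\,Q=2$ and $\mathrm{Tr}_B\,Q=I_2$. An extension of $\mu$ is an s-finite Borel measure $\omega$ on matrices that is concentrated on the states $\gamma$ with $\gamma_A=\frac1{d_A}I$ and $\mathrm{rank}\,\gamma\le d_A$ and satisfies $\omega(X)=\mu(X)$ for all Borel $X\subset\mathcal Y$. (ii) Parameters for $\gamma_A$. Let $\eta$ be the push-forward under $(\zeta,U)\mapsto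 U\,\mathrm{diag}(\zeta)\,U^\dagger$ of the product of normalized Lebesgue measure on $\{\zeta: 0\le\zeta_1\le\dots\le\zeta_{d_A},\ \sum_k\zeta_k=1\}$ (in the coordinates $\zeta_1,\dots,\zeta_{d_A-1}$) and normalized Haar measure on $SU(d_A)$. Then $\mu$ and $\eta$ are probability measures, $\mu$ is itself an extension of $\mu$, and for every extension $\omega$ of $\mu$ and $\omega\times\eta$-almost every pair $(\gamma',\rho)$, the matrix $\gamma=(\sqrt{d_A\rho}\otimes I)\,\gamma'\,(\sqrt{d_A\rho}\otimes I)$ is a state with $\mathrm{rank}\,\gamma\le d_A$ and $\gamma_A=\rho$, and it is entangled. -/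

import Mathlib

open MeasureTheory ProbabilityTheory
open scoped Matrix Kronecker ComplexOrder MatrixOrder

namespace RankEntanglement

/-! ### Matrices and special unitary groups as measurable spaces -/

/-- Entrywise (equivalently Borel) measurable structure on complex matrices. -/
noncomputable instance instMeasurableSpaceMatrix (m n : Type) : MeasurableSpace (Matrix m n ℂ) :=
  inferInstanceAs (MeasurableSpace (m → n → ℂ))

instance instBorelSpaceMatrix (m n : Type) [Fintype m] [Fintype n] :
    BorelSpace (Matrix m n ℂ) :=
  inferInstanceAs (BorelSpace (m → n → ℂ))

instance instSecondCountableMatrix (m n : Type) [Fintype m] [Fintype n] :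
    SecondCountableTopology (Matrix m n ℂ) :=
  inferInstanceAs (SecondCountableTopology (m → n → ℂ))

/-- The group `SU(d)`, with the topology of a subspace of the matrices. -/
abbrev SU (d : ℕ) : Type := Matrix.specialUnitaryGroup (Fin d) ℂ

instance instSecondCountableSU (d : ℕ) : SecondCountableTopology (SU d) :=
  TopologicalSpace.Subtype.secondCountableTopology
    {A : Matrix (Fin d) (Fin d) ℂ | A ∈ Matrix.specialUnitaryGroup (Fin d) ℂ}

instance instIsTopologicalGroupSU (d : ℕ) : IsTopologicalGroup (SU d) where
  continuous_inv := by
    refine Continuous.subtype_mk (f := fun A : SU d => star A.1) ?_ _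
    exact continuous_subtype_val.star

instance instCompactSpaceSU (d : ℕ) : CompactSpace (SU d) := by
  refine isCompact_iff_compactSpace.mp ?_
  have hK : IsCompact (Set.pi Set.univ fun _ : Fin d =>
      Set.pi Set.univ fun _ : Fin d => Metric.closedBall (0 : ℂ) 1) :=
    isCompact_univ_pi fun _ => isCompact_univ_pi fun _ => isCompact_closedBall 0 1
  have hC : IsClosed {A : Matrix (Fin d) (Fin d) ℂ | A * star A = 1 ∧ A.det = 1} := by
    refine IsClosed.inter (isClosed_eq ?_ continuous_const) (isClosed_eq ?_ continuous_const)
    · exact continuous_id.mul continuous_id.star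
    · exact continuous_id.matrix_det
  refine (hK.of_isClosed_subset (s := _)
    (t := {A : Matrix (Fin d) (Fin d) ℂ | A * star A = 1 ∧ A.det = 1}) hC ?_).of_isClosed_subset
    ?_ ?_
  · intro A hA i _ j _
    have hU : A ∈ Matrix.unitaryGroup (Fin d) ℂ := Matrix.mem_unitaryGroup_iff.mpr hA.1
    simpa using entry_norm_bound_of_unitary hU i j
  · have hS : (Matrix.specialUnitaryGroup (Fin d) ℂ : Set (Matrix (Fin d) (Fin d) ℂ)) =
        {A : Matrix (Fin d) (Fin d) ℂ | A * star A = 1 ∧ A.det = 1} := by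
      ext A
      simp [Matrix.mem_specialUnitaryGroup_iff, Matrix.mem_unitaryGroup_iff]
    rw [hS]
    exact hC
  · intro A hA
    have h := Matrix.mem_specialUnitaryGroup_iff.mp hA
    exact ⟨Matrix.mem_unitaryGroup_iff.mp h.1, h.2⟩

/-- Normalized Haar measure on `SU(d)`. -/
noncomputable def haarSU (d : ℕ) : Measure (SU d) := Measure.haarMeasure ⊤

/-! ### Bipartite states -/

/-- Density matrices: positive semidefinite matrices of trace one. -/
def IsDensity {n : Type} [Fintype n] (ρ : Matrix n n ℂ) : Prop :=
  ρ.PosSemidef ∧ ρ.trace = 1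

/-- Separable states: convex combinations of product states. -/
def IsSeparable {m n : Type} [Fintype m] [Fintype n] (γ : Matrix (m × n) (m × n) ℂ) : Prop :=
  γ ∈ convexHull ℝ {τ : Matrix (m × n) (m × n) ℂ |
    ∃ (ρ : Matrix m m ℂ) (σ : Matrix n n ℂ), IsDensity ρ ∧ IsDensity σ ∧ τ = ρ ⊗ₖ σ}

/-- Entangled states: density matrices that are not separable. -/
def IsEntangled {m n : Type} [Fintype m] [Fintype n] (γ : Matrix (m × n) (m × n) ℂ) : Prop :=
  IsDensity γ ∧ ¬ IsSeparable γ

/-- The reduced matrix `γ_A`, the partial trace over the second factor. -/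
def traceB {m n : Type} [Fintype n] (γ : Matrix (m × n) (m × n) ℂ) : Matrix m m ℂ :=
  Matrix.of fun j k => ∑ i, γ (j, i) (k, i)

/-! ### The canonical qubit channels -/

/-- The map with `w₀ I + ∑ wₖ σₖ ↦ w₀ I + ∑ (tₖ w₀ + λₖ wₖ) σₖ`, where
`λ = (cos u, cos v, cos u cos v)` and `t = (0, 0, sin u sin v)`, in the Pauli basis. -/
noncomputable def qubitMap (u v : ℝ) (M : Matrix (Fin 2) (Fin 2) ℂ) :
    Matrix (Fin 2) (Fin 2) ℂ :=
  let w0 : ℂ := (M 0 0 + M 1 1) / 2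
  let w1 : ℂ := (M 0 1 + M 1 0) / 2
  let w2 : ℂ := Complex.I * (M 0 1 - M 1 0) / 2
  let w3 : ℂ := (M 0 0 - M 1 1) / 2
  w0 • !![1, 0; 0, 1]
    + ((Real.cos u : ℂ) * w1) • !![0, 1; 1, 0]
    + ((Real.cos v : ℂ) * w2) • !![0, -Complex.I; Complex.I, 0]
    + ((Real.sin u * Real.sin v : ℂ) * w0 + (Real.cos u * Real.cos v : ℂ) * w3)
        • !![1, 0; 0, -1]

/-- The block matrix `∑ |e_j⟩⟨e_k| ⊗ Φ(|e_j⟩⟨e_k|)` of `Φ = qubitMap u v`. -/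
noncomputable def qubitChoi (u v : ℝ) : Matrix (Fin 2 × Fin 2) (Fin 2 × Fin 2) ℂ :=
  Matrix.of fun p q => qubitMap u v (Matrix.single p.1 q.1 1) p.2 q.2

/-! ### The parameter space of states with `γ_A = I / d_A`, and its measure -/

/-- The `d × 2` matrices with `Vᴴ V = I`. -/
abbrev Isometries (d : ℕ) : Type := {V : Matrix (Fin d) (Fin 2) ℂ // Vᴴ * V = 1}

instance instSecondCountableIsometries (d : ℕ) : SecondCountableTopology (Isometries d) :=
  TopologicalSpace.Subtype.secondCountableTopology {V : Matrix (Fin d) (Fin 2) ℂ | Vᴴ * V = 1}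

/-- Left translation of an isometry by an element of `SU(d)`. -/
def leftTranslate {d : ℕ} (W : SU d) (V : Isometries d) : Isometries d :=
  ⟨W.1 * V.1, by
    have h : (W.1)ᴴ * W.1 = 1 :=
      Matrix.mem_unitaryGroup_iff'.mp (Matrix.mem_specialUnitaryGroup_iff.mp W.2).1
    rw [Matrix.conjTranspose_mul, Matrix.mul_assoc, ← Matrix.mul_assoc (W.1)ᴴ, h,
      Matrix.one_mul, V.2]⟩

/-- The unit sphere of `ℂ^d`. -/
abbrev UnitSphere (d : ℕ) : Type := Metric.sphere (0 : EuclideanSpace ℂ (Fin d)) 1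

/-- The indices of the basis vectors other than the first two. -/
abbrev Rest (d : ℕ) : Type := {k : Fin d // 2 ≤ k.val}

/-- The inclusion of `ℂ²` into `ℂ^d` as the span of the first two basis vectors. -/
def incl (d : ℕ) : Matrix (Fin d) (Fin 2) ℂ :=
  Matrix.of fun i j => if i.val = j.val then 1 else 0

/-- With `g_k` the columns of `U`, the matrix
`(1 / d_A) (Q ⊕ ∑_{k ≥ 3} |g_k⟩⟨g_k| ⊗ |ψ_k⟩⟨ψ_k|)`,
where `Q` is placed on `span {g_1, g_2} ⊗ range V`. -/
noncomputable def assemble {dA dB : ℕ} (Q : Matrix (Fin 2 × Fin 2) (Fin 2 × Fin 2) ℂ)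
    (V : Isometries dB) (U : Matrix (Fin dA) (Fin dA) ℂ) (ψ : Rest dA → UnitSphere dB) :
    Matrix (Fin dA × Fin dB) (Fin dA × Fin dB) ℂ :=
  (1 / (dA : ℂ)) •
    ((U ⊗ₖ (1 : Matrix (Fin dB) (Fin dB) ℂ)) *
      ((incl dA ⊗ₖ V.1) * Q * (incl dA ⊗ₖ V.1)ᴴ +
        ∑ k : Rest dA, Matrix.single k.1 k.1 (1 : ℂ) ⊗ₖ
          Matrix.vecMulVec (fun i => (ψ k).1 i) (fun i => star ((ψ k).1 i))) *
      (U ⊗ₖ (1 : Matrix (Fin dB) (Fin dB) ℂ))ᴴ)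

/-- The set of states of the block form `(1 / d_A) (Q ⊕ P_3 ⊕ ⋯ ⊕ P_{d_A})`, with respect to some
orthonormal basis of `ℂ^{d_A}`, where `P_k` are rank one projections and `Q` has rank two,
`Tr_B Q = I_2`, and lives on a subspace `ℂ² ⊗ W` with `dim W = 2`. -/
def blockStates (dA dB : ℕ) : Set (Matrix (Fin dA × Fin dB) (Fin dA × Fin dB) ℂ) :=
  {γ | ∃ (Q : Matrix (Fin 2 × Fin 2) (Fin 2 × Fin 2) ℂ) (V : Isometries dB)
    (U : Matrix (Fin dA) (Fin dA) ℂ) (ψ : Rest dA → UnitSphere dB),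
    Q.PosSemidef ∧ Q.rank = 2 ∧ traceB Q = 1 ∧ U ∈ Matrix.unitaryGroup (Fin dA) ℂ ∧
      γ = assemble Q V U ψ}

/-- The parameter space `[0, π/2]² × {isometries} × SU(d_A) × (spheres)^{d_A - 2}`; the measure on
the first factor is concentrated on the square. -/
abbrev Params (dA dB : ℕ) : Type :=
  (ℝ × ℝ) × Isometries dB × SU dA × (Rest dA → UnitSphere dB)

/-- Normalized Lebesgue measure on the square `[0, π/2]²`. -/
noncomputable def squareMeasure : Measure (ℝ × ℝ) :=
  cond volume (Set.Icc 0 (Real.pi / 2) ×ˢ Set.Icc 0 (Real.pi / 2))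

/-- The product measure on the parameter space. -/
noncomputable def paramMeasure (dA dB : ℕ) (v : Measure (Isometries dB))
    (n : Measure (UnitSphere dB)) : Measure (Params dA dB) :=
  squareMeasure.prod (v.prod ((haarSU dA).prod (Measure.pi fun _ : Rest dA => n)))

/-- The state with given parameters. -/
noncomputable def paramState (dA dB : ℕ) (x : Params dA dB) :
    Matrix (Fin dA × Fin dB) (Fin dA × Fin dB) ℂ :=
  assemble (qubitChoi x.1.1 x.1.2) x.2.1 x.2.2.1.1 x.2.2.2

/-- The measure `μ(X) = μ̃(G⁻¹ X)` on states with `γ_A = I / d_A`. -/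
noncomputable def channelMeasure (dA dB : ℕ) (v : Measure (Isometries dB))
    (n : Measure (UnitSphere dB)) :
    Measure (Matrix (Fin dA × Fin dB) (Fin dA × Fin dB) ℂ) :=
  (paramMeasure dA dB v n).map (paramState dA dB)

/-- `ω` lives on the states with `γ_A = I / d_A` and rank at most `d_A`, and it agrees with the
measure `channelMeasure` on the set `blockStates`. -/
def IsExtension (dA dB : ℕ) (v : Measure (Isometries dB)) (n : Measure (UnitSphere dB))
    (ω : Measure (Matrix (Fin dA × Fin dB) (Fin dA × Fin dB) ℂ)) : Prop :=
  (∀ᵐ γ ∂ω, IsDensity γ ∧ γ.rank ≤ dA ∧ traceB γ = (1 / (dA : ℂ)) • 1) ∧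
    ∀ X ⊆ blockStates dA dB, MeasurableSet X → ω X = channelMeasure dA dB v n X

/-! ### The measure on density matrices of `A` -/

/-- The vector `(x_1, …, x_{d-1}, 1 - ∑ x_i)`. -/
noncomputable def completeSpectrum (d : ℕ) (x : Fin (d - 1) → ℝ) : Fin d → ℝ :=
  fun i => if h : i.val < d - 1 then x ⟨i.val, h⟩ else 1 - ∑ j, x j

/-- The ordered spectral simplex `0 ≤ ζ_1 ≤ ⋯ ≤ ζ_d`, `∑ ζ_i = 1`, in the coordinates
`ζ_1, …, ζ_{d-1}`. -/
def spectralSimplex (d : ℕ) : Set (Fin (d - 1) → ℝ) :=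
  {x | (∀ i, 0 ≤ completeSpectrum d x i) ∧ Monotone (completeSpectrum d x)}

/-- The density matrix `U Λ_ζ Uᴴ`. -/
noncomputable def spectralState (d : ℕ) (p : (Fin (d - 1) → ℝ) × SU d) :
    Matrix (Fin d) (Fin d) ℂ :=
  p.2.1 * Matrix.diagonal (fun i => (completeSpectrum d p.1 i : ℂ)) * (p.2.1)ᴴ

/-- The measure `η` on density matrices: normalized Lebesgue measure on the spectral simplex times
Haar measure on `SU(d)`, pushed forward by `(ζ, U) ↦ U Λ_ζ Uᴴ`. -/
noncomputable def spectralMeasure (d : ℕ) : Measure (Matrix (Fin d) (Fin d) ℂ) :=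
  ((cond volume (spectralSimplex d)).prod (haarSU d)).map (spectralState d)

/-! ### Removing the restriction on `γ_A` -/

/-- The state `(√(d_A ρ) ⊗ I) γ (√(d_A ρ) ⊗ I)`, whose reduced matrix is `ρ` when that of `γ` is
`I / d_A`. -/
noncomputable def withMarginal (dA dB : ℕ)
    (p : Matrix (Fin dA × Fin dB) (Fin dA × Fin dB) ℂ × Matrix (Fin dA) (Fin dA) ℂ) :
    Matrix (Fin dA × Fin dB) (Fin dA × Fin dB) ℂ :=
  (CFC.sqrt ((dA : ℂ) • p.2) ⊗ₖ (1 : Matrix (Fin dB) (Fin dB) ℂ)) * p.1 *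
    (CFC.sqrt ((dA : ℂ) • p.2) ⊗ₖ (1 : Matrix (Fin dB) (Fin dB) ℂ))

end RankEntanglement

open RankEntanglement

/-! A separable state with maximally mixed marginal and rank at most `d_A` is very rigid. Write `d_A
γ` as a sum of projections onto `a_i ⊗ b_i` with unit `b_i`; the marginal condition says that the
projections onto the `a_i`, suitably weighted by their lengths, sum to the identity. A functional
`g` vanishing on no `b_i` makes `1 ⊗ g` map the range of `γ` onto `ℂ^{d_A}`, hence bijectively by
the rank bound. Its inverse followed by `1 ⊗ (coordinate x)` is an operator with every `a_i` as
eigenvector, for the eigenvalue `b_i x / g(b_i)` (`exists_mul_eq_mul_diagonal`). Such an operator is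
normal, so `a_i ⊥ a_j` unless `b_i` and `b_j` are proportional (`gram_eq_zero_of_eigenvalue_ne`).
Grouping proportional `b_i` shows that `γ` is a uniform mixture of product states with orthonormal
first factors (`SepCone.exists_unitary`).

These mixtures form a compact set of block states, on which every extension agrees with `μ`, so it
suffices that `μ` does not charge them. If a parametrized state is such a mixture, compression to
its first block makes `qubitChoi u v` separable; a minor of the partial transpose excludes this when
`cos u cos v > 0`, that is, almost everywhere on the square.

Finally `ρ` is invertible almost surely, and then the local map `√(d_A ρ) ⊗ 1` can be undone without
leaving the separable cone. Normalization plays no role in these arguments, which is why they use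
`SepCone`. -/

namespace RankEntanglement

/-! ### Sums of projections onto product vectors -/

/-- The product vector `a ⊗ b`. -/
def prodVec {m n : Type} (a : m → ℂ) (b : n → ℂ) : m × n → ℂ := fun p => a p.1 * b p.2

/-- Unnormalized separable states: finite sums of `|a ⊗ b⟩⟨a ⊗ b|`. -/
def SepCone {m n : Type} (γ : Matrix (m × n) (m × n) ℂ) : Prop :=
  ∃ (ι : Type) (_ : Fintype ι) (a : ι → m → ℂ) (b : ι → n → ℂ),
    γ = ∑ i, Matrix.vecMulVec (prodVec (a i) (b i)) (star (prodVec (a i) (b i)))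

section
variable {m n m' n' : Type}

theorem SepCone.add {γ τ : Matrix (m × n) (m × n) ℂ} (hγ : SepCone γ) (hτ : SepCone τ) :
    SepCone (γ + τ) := by
  obtain ⟨ι, _, a, b, rfl⟩ := hγ
  obtain ⟨κ, _, c, d, rfl⟩ := hτ
  exact ⟨ι ⊕ κ, inferInstance, Sum.elim a c, Sum.elim b d, by simp⟩

theorem SepCone.smul {γ : Matrix (m × n) (m × n) ℂ} (hγ : SepCone γ) {t : ℝ} (ht : 0 ≤ t) :
    SepCone (t • γ) := by
  obtain ⟨ι, _, a, b, rfl⟩ := hγ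
  refine ⟨ι, inferInstance, fun i => (Real.sqrt t : ℂ) • a i, b, ?_⟩
  rw [Finset.smul_sum]
  refine Finset.sum_congr rfl fun i _ => ?_
  ext p q
  have h : (Real.sqrt t : ℂ) * Real.sqrt t = t := by
    rw [← Complex.ofReal_mul, Real.mul_self_sqrt ht]
  simp [Matrix.vecMulVec_apply, prodVec, ← h]
  ring

theorem PosSemidef.exists_sum_vecMulVec [Fintype m] {A : Matrix m m ℂ} (hA : A.PosSemidef) :
    ∃ a : m → m → ℂ, A = ∑ i, Matrix.vecMulVec (a i) (star (a i)) := by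
  classical
  obtain ⟨B, rfl⟩ := CStarAlgebra.nonneg_iff_eq_star_mul_self.mp hA.nonneg
  refine ⟨fun i => star (B i), ?_⟩
  ext j k
  simp [Matrix.mul_apply, Matrix.sum_apply, Matrix.vecMulVec_apply, Matrix.star_eq_conjTranspose]

theorem SepCone.kronecker [Fintype m] [Fintype n] {ρ : Matrix m m ℂ} {σ : Matrix n n ℂ}
    (hρ : ρ.PosSemidef) (hσ : σ.PosSemidef) : SepCone (ρ ⊗ₖ σ) := by
  obtain ⟨a, rfl⟩ := PosSemidef.exists_sum_vecMulVec hρ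
  obtain ⟨b, rfl⟩ := PosSemidef.exists_sum_vecMulVec hσ
  refine ⟨m × n, inferInstance, fun i => a i.1, fun i => b i.2, ?_⟩
  ext p q
  simp only [Matrix.kroneckerMap_apply, Matrix.sum_apply, Matrix.vecMulVec_apply, prodVec,
    Finset.sum_mul_sum, Fintype.sum_prod_type, Pi.star_apply, star_mul']
  exact Finset.sum_congr rfl fun i _ => Finset.sum_congr rfl fun j _ => by ring

/-- The cone is convex and contains the product states. Only this direction matters, since
entanglement is proved by exclusion from the cone. -/
theorem IsSeparable.sepCone [Fintype m] [Fintype n] {γ : Matrix (m × n) (m × n) ℂ}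
    (h : IsSeparable γ) : SepCone γ := by
  refine convexHull_min (t := {γ | SepCone γ}) ?_ ?_ h
  · rintro τ ⟨ρ, σ, hρ, hσ, rfl⟩
    exact SepCone.kronecker hρ.1 hσ.1
  · intro x hx y hy s t hs ht _
    exact (SepCone.smul hx hs).add (SepCone.smul hy ht)

theorem kronecker_mulVec_prodVec [Fintype m] [Fintype n] (K : Matrix m' m ℂ) (L : Matrix n' n ℂ)
    (a : m → ℂ) (b : n → ℂ) :
    (K ⊗ₖ L) *ᵥ prodVec a b = prodVec (K *ᵥ a) (L *ᵥ b) := by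
  ext p
  simp only [Matrix.mulVec, dotProduct, prodVec, Matrix.kroneckerMap_apply, Finset.sum_mul_sum,
    Fintype.sum_prod_type]
  exact Finset.sum_congr rfl fun i _ => Finset.sum_congr rfl fun j _ => by ring

theorem mul_vecMulVec_star_mul_conjTranspose [Fintype m] (K : Matrix m' m ℂ) (w : m → ℂ) :
    K * Matrix.vecMulVec w (star w) * Kᴴ = Matrix.vecMulVec (K *ᵥ w) (star (K *ᵥ w)) := by
  rw [Matrix.mul_vecMulVec, Matrix.vecMulVec_mul, Matrix.star_mulVec]

theorem SepCone.conj [Fintype m] [Fintype n] {γ : Matrix (m × n) (m × n) ℂ} (hγ : SepCone γ)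
    (K : Matrix m' m ℂ) (L : Matrix n' n ℂ) : SepCone ((K ⊗ₖ L) * γ * (K ⊗ₖ L)ᴴ) := by
  obtain ⟨ι, _, a, b, rfl⟩ := hγ
  refine ⟨ι, inferInstance, fun i => K *ᵥ a i, fun i => L *ᵥ b i, ?_⟩
  rw [Matrix.mul_sum, Matrix.sum_mul]
  refine Finset.sum_congr rfl fun i _ => ?_
  rw [mul_vecMulVec_star_mul_conjTranspose, kronecker_mulVec_prodVec]

/-- The positivity of a `2 × 2` minor of the partial transpose. -/
theorem SepCone.norm_sq_le {γ : Matrix (m × n) (m × n) ℂ} (hγ : SepCone γ) (j k : m) (x y : n) :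
    ‖γ (j, x) (k, y)‖ ^ 2 ≤ ‖γ (j, y) (j, y)‖ * ‖γ (k, x) (k, x)‖ := by
  obtain ⟨ι, _, a, b, rfl⟩ := hγ
  have hdiag : ∀ (l : m) (z : n), ‖(∑ i, Matrix.vecMulVec (prodVec (a i) (b i))
      (star (prodVec (a i) (b i)))) (l, z) (l, z)‖ = ∑ i, (‖a i l‖ * ‖b i z‖) ^ 2 := by
    intro l z
    have : (∑ i, Matrix.vecMulVec (prodVec (a i) (b i))
      (star (prodVec (a i) (b i)))) (l, z) (l, z) = ((∑ i, (‖a i l‖ * ‖b i z‖) ^ 2 : ℝ) : ℂ) := by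
      rw [Matrix.sum_apply, Complex.ofReal_sum]
      refine Finset.sum_congr rfl fun i _ => ?_
      simp only [Matrix.vecMulVec_apply, prodVec, Pi.star_apply]
      rw [← norm_mul, Complex.ofReal_pow, ← Complex.conj_mul', mul_comm]
      rfl
    rw [this, Complex.norm_real, Real.norm_of_nonneg]
    exact Finset.sum_nonneg fun i _ => sq_nonneg _
  rw [hdiag, hdiag]
  -- Moduli of product vectors do not see which factor is conjugated, so `x` and `y` may trade
  -- places in each summand; then Cauchy–Schwarz over `i` applies.
  refine le_trans ?_ (Finset.sum_mul_sq_le_sq_mul_sq _ _ _)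
  refine pow_le_pow_left₀ (norm_nonneg _) ?_ 2
  rw [Matrix.sum_apply]
  refine (norm_sum_le _ _).trans (le_of_eq ?_)
  refine Finset.sum_congr rfl fun i _ => ?_
  simp only [Matrix.vecMulVec_apply, prodVec, Pi.star_apply, norm_mul, norm_star]
  ring

/-- The factors in the second system may be taken to be unit vectors. -/
theorem SepCone.exists_unit [Fintype n] [Nonempty n] {γ : Matrix (m × n) (m × n) ℂ}
    (hγ : SepCone γ) :
    ∃ (ι : Type) (_ : Fintype ι) (A : Matrix m ι ℂ) (b : ι → EuclideanSpace ℂ n),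
      (∀ i, ‖b i‖ = 1) ∧
        ∀ p q, γ p q = ∑ i, (A p.1 i * b i p.2) * star (A q.1 i * b i q.2) := by
  classical
  obtain ⟨ι, _, a, b, rfl⟩ := hγ
  have key : ∀ i, ∃ (c : m → ℂ) (d : EuclideanSpace ℂ n), ‖d‖ = 1 ∧
      ∀ p : m × n, a i p.1 * b i p.2 = c p.1 * d p.2 := by
    intro i
    by_cases hb : b i = 0
    -- A zero `b i` contributes nothing: its first factor becomes zero and its second an arbitrary
    -- unit vector.
    · refine ⟨0, EuclideanSpace.single (Classical.arbitrary n) 1, by simp, fun p => ?_⟩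
      simp [hb]
    · have hne : WithLp.toLp 2 (b i) ≠ 0 := by
        intro h
        exact hb (by simpa using congrArg WithLp.ofLp h)
      refine ⟨fun j => a i j * ‖WithLp.toLp 2 (b i)‖,
        ((‖WithLp.toLp 2 (b i)‖⁻¹ : ℝ) : ℂ) • WithLp.toLp 2 (b i), ?_, fun p => ?_⟩
      · rw [norm_smul, Complex.norm_real, norm_inv, norm_norm,
          inv_mul_cancel₀ (norm_ne_zero_iff.mpr hne)]
      · have : (‖WithLp.toLp 2 (b i)‖ : ℂ) ≠ 0 := by exact_mod_cast norm_ne_zero_iff.mpr hne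
        simp only [PiLp.smul_apply, smul_eq_mul, Complex.ofReal_inv]
        field_simp
  choose c d hd hcd using key
  refine ⟨ι, inferInstance, Matrix.of fun j i => c i j, d, hd, fun p q => ?_⟩
  simp only [Matrix.sum_apply, Matrix.vecMulVec_apply, prodVec, Pi.star_apply, hcd,
    Matrix.of_apply]
end

/-! ### Separable states of least rank -/

section
variable {m n ι : Type} [Fintype m] [DecidableEq m] [Fintype ι] [DecidableEq ι]

/-- A matrix with a resolution of the identity by eigenvectors is normal: eigenvectors from the
resolution with distinct eigenvalues are orthogonal. -/
theorem gram_eq_zero_of_eigenvalue_ne {A : Matrix m ι ℂ} (hA : A * Aᴴ = 1) {N : Matrix m m ℂ}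
    {e : ι → ℂ} (hN : N * A = A * Matrix.diagonal e) {i j : ι} (hij : e i ≠ e j) :
    (Aᴴ * A) i j = 0 := by
  set E := Matrix.diagonal e with hE
  have hEE : Eᴴ * E = E * Eᴴ := by
    simp [hE, Matrix.diagonal_conjTranspose, Matrix.diagonal_mul_diagonal, mul_comm]
  have hN' : Aᴴ * Nᴴ = Eᴴ * Aᴴ := by
    rw [← Matrix.conjTranspose_mul, hN, Matrix.conjTranspose_mul]
  have h1 : (Aᴴ * N * Nᴴ * A).trace = (Aᴴ * A * E * Eᴴ).trace := by
    calc (Aᴴ * N * Nᴴ * A).trace = (A * Aᴴ * (N * Nᴴ)).trace := by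
          rw [Matrix.mul_assoc (Aᴴ), Matrix.trace_mul_comm, Matrix.mul_assoc]
      _ = (N * (A * Aᴴ) * Nᴴ).trace := by rw [hA]; simp
      _ = (A * E * (Eᴴ * Aᴴ)).trace := by
          rw [← hN', ← hN]; simp only [Matrix.mul_assoc]
      _ = (Aᴴ * A * E * Eᴴ).trace := by
          rw [← Matrix.mul_assoc, Matrix.trace_mul_comm]; simp only [Matrix.mul_assoc]
  have h2 : Aᴴ * N * (A * Eᴴ) = Aᴴ * A * E * Eᴴ := by
    rw [← Matrix.mul_assoc, Matrix.mul_assoc (Aᴴ) N A, hN]; simp only [Matrix.mul_assoc]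
  have h3 : (E * Aᴴ * (Nᴴ * A)).trace = (Aᴴ * A * E * Eᴴ).trace := by
    calc (E * Aᴴ * (Nᴴ * A)).trace = (E * (Aᴴ * Nᴴ) * A).trace := by
          simp only [Matrix.mul_assoc]
      _ = (E * Eᴴ * (Aᴴ * A)).trace := by rw [hN']; simp only [Matrix.mul_assoc]
      _ = (Aᴴ * A * E * Eᴴ).trace := by rw [Matrix.trace_mul_comm]; simp only [Matrix.mul_assoc]
  have h4 : (E * Aᴴ * (A * Eᴴ)).trace = (Aᴴ * A * E * Eᴴ).trace := by
    rw [Matrix.mul_assoc E, Matrix.trace_mul_comm, ← Matrix.mul_assoc, Matrix.mul_assoc _ _ E, hEE]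
    simp only [Matrix.mul_assoc]
  -- The squared Hilbert–Schmidt norm of this difference expands into four traces, all equal by the
  -- computations above, with signs that cancel.
  have hW : Nᴴ * A - A * Eᴴ = 0 := by
    rw [← Matrix.trace_conjTranspose_mul_self_eq_zero_iff]
    simp only [Matrix.conjTranspose_sub, Matrix.conjTranspose_mul,
      Matrix.conjTranspose_conjTranspose, Matrix.sub_mul, Matrix.mul_sub, Matrix.trace_sub]
    rw [← Matrix.mul_assoc (Aᴴ * N), h1, h2, h3, h4]
    ring
  have hW' : Aᴴ * N = E * Aᴴ := by
    have := congrArg Matrix.conjTranspose (sub_eq_zero.mp hW)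
    simpa using this
  -- Both sides equal `Aᴴ * N * A`, as the columns of `A` are right eigenvectors of `N` and the rows
  -- of `Aᴴ` left ones.
  have hcomm : E * (Aᴴ * A) = Aᴴ * A * E := by
    rw [← Matrix.mul_assoc, ← hW', Matrix.mul_assoc, hN, Matrix.mul_assoc]
  have := congrFun (congrFun hcomm i) j
  rw [hE, Matrix.diagonal_mul, Matrix.mul_diagonal] at this
  have h0 : (e i - e j) * (Aᴴ * A) i j = 0 := by rw [sub_mul, this]; ring
  exact (mul_eq_zero.mp h0).resolve_left (sub_ne_zero.mpr hij)

/-- A resolution of the identity by vectors labelled in such a way that vectors with distinct labels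
are orthogonal is compatible with some orthonormal basis. -/
theorem exists_unitary_of_gram_eq_zero {β : Type} {A : Matrix m ι ℂ} (hA : A * Aᴴ = 1) (B : ι → β)
    (hB : ∀ i j, B i ≠ B j → (Aᴴ * A) i j = 0) :
    ∃ U ∈ Matrix.unitaryGroup m ℂ, ∃ f : m → ι, ∀ k i, (Uᴴ * A) k i ≠ 0 → B i = B (f k) := by
  -- Distinct labels become distinct real numbers, to serve as eigenvalues of a Hermitian matrix
  -- whose eigenbasis is the required one.
  obtain ⟨r, hr⟩ := exists_injective_nat (Set.range B)
  set c : ι → ℂ := fun i => ((r ⟨B i, Set.mem_range_self i⟩ : ℕ) : ℂ) with hc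
  have hcB : ∀ i j, c i = c j ↔ B i = B j := by
    intro i j
    simp only [hc, Nat.cast_inj]
    exact hr.eq_iff.trans Subtype.mk_eq_mk
  set R := Matrix.diagonal c with hR
  have hRc : Rᴴ = R := by
    simp only [hR, Matrix.diagonal_conjTranspose]
    congr 1
    ext i
    simp [hc]
  have hcomm : R * (Aᴴ * A) = Aᴴ * A * R := by
    ext i j
    rw [hR, Matrix.diagonal_mul, Matrix.mul_diagonal]
    by_cases h : B i = B j
    · rw [(hcB i j).2 h, mul_comm]
    · simp [hB i j h]
  have hM : (A * R * Aᴴ).IsHermitian := by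
    unfold Matrix.IsHermitian
    simp only [Matrix.conjTranspose_mul, Matrix.conjTranspose_conjTranspose, hRc, Matrix.mul_assoc]
  -- Column `i` of `A` is an eigenvector (or zero) for `c i`, because the Gram matrix is block
  -- diagonal with respect to the labels.
  have hMA : A * R * Aᴴ * A = A * R := by
    rw [Matrix.mul_assoc, Matrix.mul_assoc, hcomm, ← Matrix.mul_assoc, ← Matrix.mul_assoc, hA,
      Matrix.one_mul]
  set U : Matrix m m ℂ := hM.eigenvectorUnitary.1 with hU
  have hUmem : U ∈ Matrix.unitaryGroup m ℂ := hM.eigenvectorUnitary.2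
  have hUU : Uᴴ * U = 1 := Matrix.mem_unitaryGroup_iff'.mp hUmem
  have hUU' : U * Uᴴ = 1 := Matrix.mem_unitaryGroup_iff.mp hUmem
  set L : Matrix m m ℂ := Matrix.diagonal (RCLike.ofReal ∘ hM.eigenvalues) with hL
  have hspec : A * R * Aᴴ = U * L * Uᴴ := by
    have := hM.spectral_theorem
    rw [Unitary.conjStarAlgAut_apply] at this
    exact this
  have hC : L * (Uᴴ * A) = Uᴴ * A * R := by
    rw [Matrix.mul_assoc _ A, ← hMA, hspec]
    simp only [← Matrix.mul_assoc]
    rw [hUU, Matrix.one_mul]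
  have hval : ∀ k i, (Uᴴ * A) k i ≠ 0 → c i = (hM.eigenvalues k : ℂ) := by
    intro k i hki
    have h1 : (L * (Uᴴ * A)) k i = (hM.eigenvalues k : ℂ) * (Uᴴ * A) k i :=
      Matrix.diagonal_mul _ _ _ _
    have h2 : (Uᴴ * A * R) k i = (Uᴴ * A) k i * c i := Matrix.mul_diagonal _ _ _ _
    rw [hC, h2, mul_comm] at h1
    exact mul_right_cancel₀ hki h1
  -- The rows of `Uᴴ * A` are unit vectors; any nonzero entry of row `k` can serve to define `f k`.
  have hex : ∀ k, ∃ i, (Uᴴ * A) k i ≠ 0 := by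
    intro k
    by_contra! h
    have h1 : (Uᴴ * A) * (Uᴴ * A)ᴴ = 1 := by
      rw [Matrix.conjTranspose_mul, Matrix.conjTranspose_conjTranspose, Matrix.mul_assoc,
        ← Matrix.mul_assoc A, hA, Matrix.one_mul, hUU]
    have := congrFun (congrFun h1 k) k
    rw [Matrix.mul_apply] at this
    simp [h] at this
  choose f hf using hex
  exact ⟨U, hUmem, f, fun k i hki => (hcB _ _).1 ((hval k i hki).trans (hval k _ (hf k)).symm)⟩

/-- If the vectors `aᵢ ⊗ bᵢ` span a space of the least possible dimension, then rescaling each `aᵢ`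
by a ratio of linear functionals of `bᵢ` extends to a linear map. -/
theorem exists_mul_eq_mul_diagonal [Fintype n] {A : Matrix m ι ℂ} (hA : A * Aᴴ = 1)
    (b : ι → n → ℂ)
    (hrank : (Matrix.of fun (p : m × n) i => A p.1 i * b i p.2).rank ≤ Fintype.card m)
    (g : Module.Dual ℂ (n → ℂ)) (hg : ∀ i, g (b i) ≠ 0) (x : n) :
    ∃ N : Matrix m m ℂ, N * A = A * Matrix.diagonal fun i => b i x / g (b i) := by
  set Y : Matrix (m × n) ι ℂ := Matrix.of fun p i => A p.1 i * b i p.2 with hY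
  -- `T h` is `1 ⊗ h`, which sends `a_i ⊗ b_i` to `h (b_i) a_i`.
  let T : Module.Dual ℂ (n → ℂ) → ((m × n → ℂ) →ₗ[ℂ] (m → ℂ)) := fun h =>
    LinearMap.pi fun j => h.comp (LinearMap.funLeft ℂ ℂ fun y => (j, y))
  have hT : ∀ h c, T h (Y *ᵥ c) = A *ᵥ fun i => h (b i) * c i := by
    intro h c
    ext j
    have : (fun y => (Y *ᵥ c) (j, y)) = ∑ i, (A j i * c i) • b i := by
      ext y
      simp only [Matrix.mulVec, dotProduct, hY, Matrix.of_apply, Finset.sum_apply, Pi.smul_apply,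
        smul_eq_mul]
      exact Finset.sum_congr rfl fun i _ => by ring
    change h (fun y => (Y *ᵥ c) (j, y)) = _
    rw [this, map_sum]
    simp only [map_smul, smul_eq_mul, Matrix.mulVec, dotProduct]
    exact Finset.sum_congr rfl fun i _ => by ring
  let R := LinearMap.range Y.mulVecLin
  let t : R →ₗ[ℂ] (m → ℂ) := (T g).domRestrict R
  -- The preimage of `w` comes from `w = A (Aᴴ w)`, each coefficient being divided by `g (b i)`.
  have hsurj : Function.Surjective t := by
    intro w
    refine ⟨⟨Y *ᵥ fun i => (g (b i))⁻¹ * (Aᴴ *ᵥ w) i, ⟨_, Y.mulVecLin_apply _⟩⟩, ?_⟩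
    change T g (Y *ᵥ _) = w
    rw [hT]
    have : (fun i => g (b i) * ((g (b i))⁻¹ * (Aᴴ *ᵥ w) i)) = Aᴴ *ᵥ w := by
      ext i
      rw [← mul_assoc, mul_inv_cancel₀ (hg i), one_mul]
    rw [this, Matrix.mulVec_mulVec, hA, Matrix.one_mulVec]
  have hfin : Module.finrank ℂ R = Module.finrank ℂ (m → ℂ) := by
    refine le_antisymm ?_ (LinearMap.finrank_le_finrank_of_surjective hsurj)
    rw [Module.finrank_fintype_fun_eq_card]
    exact hrank
  have hinj : Function.Injective t :=
    (LinearMap.injective_iff_surjective_of_finrank_eq_finrank hfin).mpr hsurj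
  let φ := LinearEquiv.ofBijective t ⟨hinj, hsurj⟩
  let F : (m → ℂ) →ₗ[ℂ] (m → ℂ) := (T (LinearMap.proj x)) ∘ₗ R.subtype ∘ₗ φ.symm.toLinearMap
  refine ⟨LinearMap.toMatrix' F, ?_⟩
  ext j i
  have hcol : F (fun j => A j i) = fun j => A j i * (b i x / g (b i)) := by
    have h1 : ∀ h : Module.Dual ℂ (n → ℂ), T h (Y *ᵥ Pi.single i ((g (b i))⁻¹)) =
        fun j => A j i * (h (b i) / g (b i)) := by
      intro h
      rw [hT]
      have : (fun i' => h (b i') * (Pi.single i ((g (b i))⁻¹) : ι → ℂ) i') =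
          Pi.single i (h (b i) / g (b i)) := by
        ext i'
        by_cases hi : i' = i
        · subst hi; simp [div_eq_mul_inv]
        · simp [hi]
      rw [this]
      ext j
      simp [div_eq_mul_inv]
    have h2 : φ ⟨Y *ᵥ Pi.single i ((g (b i))⁻¹), ⟨_, Y.mulVecLin_apply _⟩⟩ = fun j => A j i := by
      refine (h1 g).trans ?_
      ext j
      rw [div_self (hg i), mul_one]
    change T (LinearMap.proj x) (φ.symm (fun j => A j i) : R) = _
    rw [← h2, LinearEquiv.symm_apply_apply]
    exact h1 _
  rw [Matrix.mul_diagonal, ← congrFun hcol j, ← LinearMap.toMatrix'_mulVec]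
  rfl

end

/-- A separable state whose rank does not exceed that of its maximally mixed marginal is a mixture of
orthogonal product states. -/
theorem SepCone.exists_unitary {m n : Type} [Fintype m] [DecidableEq m] [Fintype n] [DecidableEq n]
    [Nonempty n] {γ : Matrix (m × n) (m × n) ℂ} (hγ : SepCone γ) (htr : traceB γ = 1)
    (hrank : γ.rank ≤ Fintype.card m) :
    ∃ U ∈ Matrix.unitaryGroup m ℂ, ∃ ψ : m → EuclideanSpace ℂ n, (∀ k, ‖ψ k‖ = 1) ∧
      γ = (U ⊗ₖ (1 : Matrix n n ℂ)) *
        (∑ k, Matrix.single k k (1 : ℂ) ⊗ₖ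
          Matrix.vecMulVec (fun i => ψ k i) (fun i => star (ψ k i))) *
        (U ⊗ₖ (1 : Matrix n n ℂ))ᴴ := by
  classical
  obtain ⟨ι, _, A, b, hb, hγ⟩ := hγ.exists_unit
  have hnorm : ∀ i, ∑ x, b i x * star (b i x) = 1 := by
    intro i
    have h := EuclideanSpace.norm_sq_eq (b i)
    rw [hb i] at h
    have h2 : ((1 : ℝ) ^ 2 : ℂ) = ((∑ x, ‖b i x‖ ^ 2 : ℝ) : ℂ) := by exact_mod_cast h
    rw [Complex.ofReal_sum] at h2
    simp only [Complex.ofReal_one, one_pow] at h2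
    rw [h2]
    refine Finset.sum_congr rfl fun x _ => ?_
    rw [Complex.ofReal_pow, ← Complex.mul_conj']
    rfl
  have hA : A * Aᴴ = 1 := by
    rw [← htr]
    ext j k
    simp only [traceB, Matrix.of_apply, hγ, Matrix.mul_apply, Matrix.conjTranspose_apply, star_mul']
    rw [Finset.sum_comm]
    refine Finset.sum_congr rfl fun i _ => ?_
    rw [← mul_one (A j i * star (A k i)), ← hnorm i, Finset.mul_sum]
    exact Finset.sum_congr rfl fun x _ => by ring
  have hY : (Matrix.of fun (p : m × n) i => A p.1 i * b i p.2).rank ≤ Fintype.card m := by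
    have h : γ = (Matrix.of fun (p : m × n) i => A p.1 i * b i p.2) *
        (Matrix.of fun (p : m × n) i => A p.1 i * b i p.2)ᴴ := by
      ext p q
      simp [hγ, Matrix.mul_apply]
    rwa [h, Matrix.rank_self_mul_conjTranspose] at hrank
  have hb0 : ∀ i, (fun x => b i x) ≠ 0 := by
    intro i h
    have := hnorm i
    have h' : ∀ x, b i x = 0 := congrFun h
    simp [h'] at this
  obtain ⟨g, hg⟩ := Module.exists_dual_forall_apply_ne_zero (K := ℂ) (fun i x => b i x) hb0
  let B : ι → Matrix n n ℂ := fun i => Matrix.of fun x y => b i x * star (b i y)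
  have hB : ∀ i j, B i ≠ B j → (Aᴴ * A) i j = 0 := by
    intro i j hij
    obtain ⟨x, hx⟩ : ∃ x, b i x / g (fun x => b i x) ≠ b j x / g (fun x => b j x) := by
      -- If all ratios agree, then `b i = c • b j`, and the unit norms force `|c| = 1`, so the two
      -- projections coincide. This is why the labels are projections and not vectors.
      by_contra! h
      set c := g (fun x => b i x) / g (fun x => b j x) with hc
      have hbc : ∀ x, b i x = c * b j x := by
        intro x
        have := h x
        rw [div_eq_iff (hg i)] at this
        rw [this, hc]
        ring
      have hcc : c * star c = 1 := by
        rw [← hnorm i, ← mul_one (c * star c), ← hnorm j, Finset.mul_sum]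
        refine Finset.sum_congr rfl fun x _ => ?_
        rw [hbc x, star_mul']
        ring
      refine hij ?_
      ext x y
      simp only [B, Matrix.of_apply]
      rw [hbc x, hbc y, star_mul']
      linear_combination (b j x * star (b j y)) * hcc
    obtain ⟨N, hN⟩ := exists_mul_eq_mul_diagonal hA (fun i x => b i x) hY g hg x
    exact gram_eq_zero_of_eigenvalue_ne hA hN hx
  obtain ⟨U, hU, f, hf⟩ := exists_unitary_of_gram_eq_zero hA B hB
  refine ⟨U, hU, fun k => b (f k), fun k => hb _, ?_⟩
  have hUU : Uᴴ * U = 1 := Matrix.mem_unitaryGroup_iff'.mp hU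
  have hUU' : U * Uᴴ = 1 := Matrix.mem_unitaryGroup_iff.mp hU
  set C := Uᴴ * A with hC
  have hCC : C * Cᴴ = 1 := by
    rw [hC, Matrix.conjTranspose_mul, Matrix.conjTranspose_conjTranspose, Matrix.mul_assoc,
      ← Matrix.mul_assoc A, hA, Matrix.one_mul, hUU]
  have hAC : A = U * C := by rw [hC, ← Matrix.mul_assoc, hUU', Matrix.one_mul]
  have hZ : ∀ (D : Matrix m ι ℂ), (Matrix.of fun p q => ∑ i, (D p.1 i * b i p.2) *
      star (D q.1 i * b i q.2)) = (Matrix.of fun (p : m × n) i => D p.1 i * b i p.2) *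
        (Matrix.of fun (p : m × n) i => D p.1 i * b i p.2)ᴴ := by
    intro D
    ext p q
    simp [Matrix.mul_apply]
  have hUC : (Matrix.of fun (p : m × n) i => A p.1 i * b i p.2) =
      (U ⊗ₖ (1 : Matrix n n ℂ)) * (Matrix.of fun (p : m × n) i => C p.1 i * b i p.2) := by
    ext p i
    simp only [hAC, Matrix.mul_apply, Matrix.of_apply, Matrix.kroneckerMap_apply,
      Fintype.sum_prod_type, Matrix.one_apply, Finset.sum_mul]
    refine Finset.sum_congr rfl fun k _ => ?_
    simp [mul_assoc]
  have hdiag : (Matrix.of fun p q => ∑ i, (C p.1 i * b i p.2) * star (C q.1 i * b i q.2)) =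
      ∑ k, Matrix.single k k (1 : ℂ) ⊗ₖ
          Matrix.vecMulVec (fun i => b (f k) i) (fun i => star (b (f k) i)) := by
    ext ⟨k, x⟩ ⟨l, y⟩
    -- Row `k` of `C` only meets indices with the same projection as `b (f k)`, so that projection
    -- factors out; when `k ≠ l`, orthogonality of the rows makes the block vanish.
    have h1 : ∀ i, C k i * b i x * star (C l i * b i y) =
        C k i * star (C l i) * (b (f k) x * star (b (f k) y)) := by
      intro i
      by_cases h : C k i = 0
      · simp [h]
      · have := congrFun (congrFun (hf k i h) x) y
        simp only [B, Matrix.of_apply] at this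
        rw [← this, star_mul']
        ring
    have h2 : ∑ i, C k i * star (C l i) = if k = l then 1 else 0 := by
      have := congrFun (congrFun hCC k) l
      rwa [Matrix.mul_apply, Matrix.one_apply] at this
    simp only [Matrix.of_apply, h1, ← Finset.sum_mul, h2, Matrix.sum_apply,
      Matrix.kroneckerMap_apply, Matrix.single_apply, Matrix.vecMulVec_apply]
    by_cases hkl : k = l
    · subst hkl
      simp
    · rw [if_neg hkl, zero_mul]
      refine (Finset.sum_eq_zero fun i _ => ?_).symm
      rw [if_neg (fun h => hkl (h.1.symm.trans h.2)), zero_mul]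
  rw [← hdiag, hZ, Matrix.mul_assoc, Matrix.mul_assoc, ← Matrix.conjTranspose_mul, ← Matrix.mul_assoc,
    ← hUC, ← hZ]
  ext p q
  exact hγ p q

/-! ### Mixtures of orthogonal product states -/

/-- The uniform mixture of the product states `|g_k⟩⟨g_k| ⊗ |ψ_k⟩⟨ψ_k|`, with `g_k` the columns
of `U`. -/
noncomputable def productMixture {dA dB : ℕ} (U : Matrix (Fin dA) (Fin dA) ℂ)
    (ψ : Fin dA → UnitSphere dB) : Matrix (Fin dA × Fin dB) (Fin dA × Fin dB) ℂ :=
  (1 / (dA : ℂ)) •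
    ((U ⊗ₖ (1 : Matrix (Fin dB) (Fin dB) ℂ)) *
      (∑ k, Matrix.single k k (1 : ℂ) ⊗ₖ
        Matrix.vecMulVec (fun i => (ψ k).1 i) (fun i => star ((ψ k).1 i))) *
      (U ⊗ₖ (1 : Matrix (Fin dB) (Fin dB) ℂ))ᴴ)

/-- The set of uniform mixtures of `d_A` product states with orthonormal first factors. -/
def productMixtures (dA dB : ℕ) : Set (Matrix (Fin dA × Fin dB) (Fin dA × Fin dB) ℂ) :=
  (fun x : Matrix (Fin dA) (Fin dA) ℂ × (Fin dA → UnitSphere dB) => productMixture x.1 x.2) ''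
    ((Matrix.unitaryGroup (Fin dA) ℂ : Set (Matrix (Fin dA) (Fin dA) ℂ)) ×ˢ Set.univ)

theorem isCompact_unitaryGroup (d : ℕ) :
    IsCompact (Matrix.unitaryGroup (Fin d) ℂ : Set (Matrix (Fin d) (Fin d) ℂ)) := by
  have hK : IsCompact (Set.pi Set.univ fun _ : Fin d =>
      Set.pi Set.univ fun _ : Fin d => Metric.closedBall (0 : ℂ) 1) :=
    isCompact_univ_pi fun _ => isCompact_univ_pi fun _ => isCompact_closedBall 0 1
  have hC : IsClosed {A : Matrix (Fin d) (Fin d) ℂ | A * star A = 1} :=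
    isClosed_eq (continuous_id.mul continuous_id.star) continuous_const
  have hS : (Matrix.unitaryGroup (Fin d) ℂ : Set (Matrix (Fin d) (Fin d) ℂ)) =
      {A | A * star A = 1} := by
    ext A
    exact Matrix.mem_unitaryGroup_iff
  refine hK.of_isClosed_subset (s := _)
    (t := (Matrix.unitaryGroup (Fin d) ℂ : Set (Matrix (Fin d) (Fin d) ℂ))) ?_ ?_
  · rw [hS]
    exact hC
  · intro A hA i _ j _
    simpa using entry_norm_bound_of_unitary hA i j

theorem continuous_kronecker_one {X : Type} [TopologicalSpace X] {m n : Type} [DecidableEq n]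
    {f : X → Matrix m m ℂ} (hf : Continuous f) :
    Continuous fun x => f x ⊗ₖ (1 : Matrix n n ℂ) := by
  refine continuous_matrix fun p q => ?_
  simp only [Matrix.kroneckerMap_apply]
  exact (hf.matrix_elem _ _).mul continuous_const

theorem continuous_kronecker_projection {X : Type} [TopologicalSpace X] {m n : Type}
    (S : Matrix m m ℂ) {f : X → EuclideanSpace ℂ n} (hf : Continuous f) :
    Continuous fun x => S ⊗ₖ Matrix.vecMulVec (fun i => f x i) (fun i => star (f x i)) := by
  refine continuous_matrix fun p q => ?_
  simp only [Matrix.kroneckerMap_apply, Matrix.vecMulVec_apply]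
  fun_prop

/-- Compactness supplies the measurability needed to compare an extension with `μ` on this set. -/
theorem isCompact_productMixtures (dA dB : ℕ) : IsCompact (productMixtures dA dB) := by
  refine ((isCompact_unitaryGroup dA).prod isCompact_univ).image ?_
  unfold productMixture
  have h1 : Continuous fun x : Matrix (Fin dA) (Fin dA) ℂ × (Fin dA → UnitSphere dB) =>
      x.1 ⊗ₖ (1 : Matrix (Fin dB) (Fin dB) ℂ) := continuous_kronecker_one continuous_fst
  refine Continuous.const_smul ((h1.mul ?_).mul h1.matrix_conjTranspose) (1 / (dA : ℂ))
  refine continuous_finsetSum _ fun k _ => continuous_kronecker_projection _ ?_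
  fun_prop

theorem sum_eq_sum_fin_two_add_sum_rest {d : ℕ} (hd : 2 ≤ d) {M : Type} [AddCommMonoid M]
    (F : Fin d → M) :
    ∑ k, F k = ∑ k : Fin 2, F (Fin.castLE hd k) + ∑ k : Rest d, F k.1 := by
  rw [add_comm, ← Fintype.sum_subtype_add_sum_subtype (fun k : Fin d => 2 ≤ k.val) F]
  congr 1
  let e : Fin 2 ≃ {k : Fin d // ¬ 2 ≤ k.val} :=
    { toFun := fun k => ⟨Fin.castLE hd k, not_le.mpr k.2⟩
      invFun := fun k => ⟨k.1.1, not_le.mp k.2⟩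
      left_inv := fun k => rfl
      right_inv := fun k => rfl }
  exact (Fintype.sum_equiv e _ _ fun k => rfl).symm

theorem incl_mul_single_mul {d : ℕ} (hd : 2 ≤ d) (k : Fin 2) :
    incl d * Matrix.single k k (1 : ℂ) * (incl d)ᴴ =
      Matrix.single (Fin.castLE hd k) (Fin.castLE hd k) 1 := by
  ext i j
  simp only [incl, Matrix.mul_apply, Matrix.single_apply, Matrix.of_apply,
    Matrix.conjTranspose_apply, Fin.ext_iff, Fin.val_castLE, Fin.sum_univ_two]
  fin_cases k <;> simp [← ite_and, and_comm, eq_comm]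

theorem incl_conjTranspose_mul_incl {d : ℕ} (hd : 2 ≤ d) : (incl d)ᴴ * incl d = 1 := by
  ext i j
  rw [Matrix.mul_apply, Finset.sum_eq_single (Fin.castLE hd i)]
  · simp [incl, Matrix.one_apply, Fin.ext_iff]
  · intro k _ hk
    have : k.val ≠ i.val := fun h => hk (Fin.ext h)
    simp [incl, this]
  · simp

/-- The columns of `V` are the first two Gram–Schmidt vectors of a family starting with `ψ 0`, `ψ
1`; triangularity kills all further components. Completion to an orthonormal basis covers parallel
`ψ 0` and `ψ 1`. -/
theorem exists_isometry_mulVec_eq {d : ℕ} (hd : 2 ≤ d) (ψ : Fin 2 → UnitSphere d) :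
    ∃ (V : Isometries d) (φ : Fin 2 → Fin 2 → ℂ), (∀ k, star (φ k) ⬝ᵥ φ k = 1) ∧
      ∀ k, V.1 *ᵥ φ k = fun i => (ψ k).1 i := by
  classical
  let f : Fin d → EuclideanSpace ℂ (Fin d) := fun i =>
    if i.val = 0 then (ψ 0).1 else (ψ 1).1
  have hcard : Module.finrank ℂ (EuclideanSpace ℂ (Fin d)) = Fintype.card (Fin d) := by simp
  let e := InnerProductSpace.gramSchmidtOrthonormalBasis hcard f
  have hf : ∀ k : Fin 2, f (Fin.castLE hd k) = (ψ k).1 := by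
    intro k
    fin_cases k <;> simp [f]
  have hψ : ∀ k : Fin 2, (ψ k).1 = ∑ j : Fin 2, inner ℂ (e (Fin.castLE hd j)) (ψ k).1 •
      e (Fin.castLE hd j) := by
    intro k
    conv_lhs => rw [← e.sum_repr' (ψ k).1, sum_eq_sum_fin_two_add_sum_rest hd]
    rw [Finset.sum_eq_zero (s := (Finset.univ : Finset (Rest d))), add_zero]
    intro j _
    rw [← hf k, InnerProductSpace.gramSchmidtOrthonormalBasis_inv_triangular, zero_smul]
    rw [Fin.lt_def]
    exact lt_of_lt_of_le k.2 j.2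
  let V : Matrix (Fin d) (Fin 2) ℂ := Matrix.of fun i j => e (Fin.castLE hd j) i
  have hV : Vᴴ * V = 1 := by
    ext i j
    have := orthonormal_iff_ite.mp e.orthonormal (Fin.castLE hd i) (Fin.castLE hd j)
    rw [EuclideanSpace.inner_eq_star_dotProduct] at this
    simp only [Matrix.mul_apply, Matrix.conjTranspose_apply, V, Matrix.of_apply, Matrix.one_apply]
    simp only [dotProduct, Pi.star_apply, Fin.castLE_inj] at this
    rw [← this]
    exact Finset.sum_congr rfl fun _ _ => mul_comm _ _
  have hVφ : ∀ k, V *ᵥ (fun j => inner ℂ (e (Fin.castLE hd j)) (ψ k).1) = fun i => (ψ k).1 i := by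
    intro k
    ext i
    conv_rhs => rw [hψ k]
    simp [Matrix.mulVec, dotProduct, V, mul_comm]
  refine ⟨⟨V, hV⟩, fun k j => inner ℂ (e (Fin.castLE hd j)) (ψ k).1, fun k => ?_, hVφ⟩
  have h1 : star (fun i => (ψ k).1 i) ⬝ᵥ (fun i => (ψ k).1 i) = 1 := by
    have h := inner_self_eq_norm_sq_to_K (𝕜 := ℂ) (ψ k).1
    rw [EuclideanSpace.inner_eq_star_dotProduct, dotProduct_comm] at h
    have hn : ‖(ψ k).1‖ = 1 := by simp
    rw [hn] at h
    simpa using h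
  rw [← hVφ k, Matrix.star_mulVec, ← Matrix.dotProduct_mulVec, Matrix.mulVec_mulVec, hV,
    Matrix.one_mulVec] at h1
  exact h1

/-- The first two second factors lie in a common two-dimensional subspace, so the first two terms
form a block `T * Tᴴ` whose columns `e_k ⊗ φ_k` are orthonormal. -/
theorem productMixtures_subset_blockStates {dA dB : ℕ} (hB : 2 ≤ dB) (hA : 2 ≤ dA) :
    productMixtures dA dB ⊆ blockStates dA dB := by
  rintro _ ⟨⟨U, ψ⟩, ⟨hU, -⟩, rfl⟩
  obtain ⟨V, φ, hφ, hV⟩ := exists_isometry_mulVec_eq hB fun k => ψ (Fin.castLE hA k)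
  let T : Matrix (Fin 2 × Fin 2) (Fin 2) ℂ :=
    Matrix.of fun p k => if p.1 = k then φ k p.2 else 0
  have hTT : Tᴴ * T = 1 := by
    ext k l
    simp only [Matrix.mul_apply, Matrix.conjTranspose_apply, T, Matrix.of_apply,
      Fintype.sum_prod_type, Matrix.one_apply]
    by_cases hkl : k = l
    · subst hkl
      rw [Finset.sum_eq_single k]
      · simpa [dotProduct] using hφ k
      · intro j _ hj
        simp [hj]
      · simp
    · rw [if_neg hkl]
      refine Finset.sum_eq_zero fun i _ => Finset.sum_eq_zero fun x _ => ?_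
      by_cases hi : i = k
      · have : i ≠ l := fun h => hkl (hi.symm.trans h)
        simp [this]
      · simp [hi]
  have hsum : T * Tᴴ = ∑ k, Matrix.single k k (1 : ℂ) ⊗ₖ
      Matrix.vecMulVec (φ k) (star (φ k)) := by
    ext p q
    simp only [Matrix.mul_apply, Matrix.conjTranspose_apply, T, Matrix.of_apply, Matrix.sum_apply,
      Matrix.kroneckerMap_apply, Matrix.single_apply, Matrix.vecMulVec_apply, Pi.star_apply]
    refine Finset.sum_congr rfl fun k _ => ?_
    by_cases h1 : p.1 = k <;> by_cases h2 : q.1 = k <;> simp [h1, h2, Ne.symm]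
  refine ⟨T * Tᴴ, V, U, fun k => ψ k.1, Matrix.posSemidef_self_mul_conjTranspose T, ?_, ?_, hU, ?_⟩
  · rw [Matrix.rank_self_mul_conjTranspose, ← Matrix.rank_conjTranspose_mul_self, hTT,
      Matrix.rank_one]
    simp
  · rw [hsum]
    ext j k
    simp only [traceB, Matrix.of_apply, Matrix.sum_apply, Matrix.kroneckerMap_apply,
      Matrix.single_apply, Matrix.vecMulVec_apply, Matrix.one_apply]
    rw [Finset.sum_comm]
    by_cases hjk : j = k
    · subst hjk
      rw [Finset.sum_eq_single j]
      · have := hφ j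
        rw [dotProduct_comm] at this
        simpa [dotProduct] using this
      · intro i _ hi
        simp [hi]
      · simp
    · rw [if_neg hjk]
      refine Finset.sum_eq_zero fun i _ => Finset.sum_eq_zero fun x _ => ?_
      rw [if_neg (fun h => hjk (h.1.symm.trans h.2)), zero_mul]
  · have h : (incl dA ⊗ₖ V.1) * (T * Tᴴ) * (incl dA ⊗ₖ V.1)ᴴ = ∑ k : Fin 2,
        Matrix.single (Fin.castLE hA k) (Fin.castLE hA k) (1 : ℂ) ⊗ₖ
          Matrix.vecMulVec (fun i => (ψ (Fin.castLE hA k)).1 i)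
            (fun i => star ((ψ (Fin.castLE hA k)).1 i)) := by
      rw [hsum, Matrix.mul_sum, Matrix.sum_mul]
      refine Finset.sum_congr rfl fun k _ => ?_
      rw [Matrix.conjTranspose_kronecker, ← Matrix.mul_kronecker_mul, ← Matrix.mul_kronecker_mul,
        incl_mul_single_mul hA, mul_vecMulVec_star_mul_conjTranspose, hV]
      rfl
    simp only [productMixture, assemble]
    rw [h, sum_eq_sum_fin_two_add_sum_rest hA]

/-! ### Partial traces -/

section
variable {m n m' n' : Type} [Fintype n]

theorem traceB_add (γ τ : Matrix (m × n) (m × n) ℂ) :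
    traceB (γ + τ) = traceB γ + traceB τ := by
  ext j k
  simp [traceB, Finset.sum_add_distrib]

theorem traceB_smul (c : ℂ) (γ : Matrix (m × n) (m × n) ℂ) :
    traceB (c • γ) = c • traceB γ := by
  ext j k
  simp [traceB, Finset.mul_sum]

theorem traceB_sum {ι : Type} (s : Finset ι) (γ : ι → Matrix (m × n) (m × n) ℂ) :
    traceB (∑ i ∈ s, γ i) = ∑ i ∈ s, traceB (γ i) := by
  ext j k
  simp only [traceB, Matrix.of_apply, Matrix.sum_apply]
  exact Finset.sum_comm

theorem traceB_kronecker (A : Matrix m m ℂ) (B : Matrix n n ℂ) :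
    traceB (A ⊗ₖ B) = B.trace • A := by
  ext j k
  simp [traceB, Matrix.trace, Finset.mul_sum, mul_comm]

theorem trace_traceB [Fintype m] (γ : Matrix (m × n) (m × n) ℂ) :
    (traceB γ).trace = γ.trace := by
  simp [traceB, Matrix.trace, Fintype.sum_prod_type]

/-- By linearity it suffices to treat elementary tensors, where cyclicity of the trace in the second
factor removes `L`. -/
theorem traceB_conj [Fintype m] [DecidableEq m] [DecidableEq n] [Fintype n']
    (K : Matrix m' m ℂ) {L : Matrix n' n ℂ} (hL : Lᴴ * L = 1) (γ : Matrix (m × n) (m × n) ℂ) :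
    traceB ((K ⊗ₖ L) * γ * (K ⊗ₖ L)ᴴ) = K * traceB γ * Kᴴ := by
  have hγ : γ = ∑ p, ∑ q, γ p q • (Matrix.single p.1 q.1 (1 : ℂ) ⊗ₖ
      Matrix.single p.2 q.2 (1 : ℂ)) := by
    conv_lhs => rw [Matrix.matrix_eq_sum_single γ]
    refine Finset.sum_congr rfl fun p _ => Finset.sum_congr rfl fun q _ => ?_
    rw [Matrix.single_kronecker_single, Matrix.smul_single]
    simp
  rw [hγ]
  simp only [Matrix.mul_sum, Matrix.sum_mul, traceB_sum, traceB_smul, Matrix.mul_smul,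
    Matrix.smul_mul]
  refine Finset.sum_congr rfl fun p _ => Finset.sum_congr rfl fun q _ => ?_
  rw [Matrix.conjTranspose_kronecker, ← Matrix.mul_kronecker_mul, ← Matrix.mul_kronecker_mul,
    traceB_kronecker, traceB_kronecker, Matrix.trace_mul_comm, ← Matrix.mul_assoc, hL,
    Matrix.one_mul, Matrix.mul_smul, Matrix.smul_mul]

end

/-! ### The canonical qubit channels -/

/-- A square root of `qubitChoi u v`. -/
noncomputable def qubitRoot (u v : ℝ) : Matrix (Fin 2 × Fin 2) (Fin 2) ℂ :=
  Matrix.of fun p k =>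
    ((!![Real.cos ((u - v) / 2), -Real.sin ((u - v) / 2);
        Real.sin ((u + v) / 2), Real.cos ((u + v) / 2)] p.1 p.2 *
      !![1, 0; 0, 1] (p.1 + p.2) k : ℝ) : ℂ)

/-- The two columns of `qubitRoot` are the vectorized Kraus operators of the channel, one diagonal
and one antidiagonal. Half-sums and half-differences of the angles reduce the identity to the
Pythagorean relations. -/
theorem qubitChoi_eq (u v : ℝ) : qubitChoi u v = qubitRoot u v * (qubitRoot u v)ᴴ := by
  obtain ⟨p, hp⟩ : ∃ p, (u - v) / 2 = p := ⟨_, rfl⟩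
  obtain ⟨q, hq⟩ : ∃ q, (u + v) / 2 = q := ⟨_, rfl⟩
  obtain rfl : u = q + p := by linarith
  obtain rfl : v = q - p := by linarith
  have h1 := Complex.sin_sq_add_cos_sq (p : ℂ)
  have h2 := Complex.sin_sq_add_cos_sq (q : ℂ)
  ext ⟨i, j⟩ ⟨k, l⟩
  rw [Matrix.mul_apply]
  simp only [qubitChoi, qubitRoot, qubitMap, hp, hq, Matrix.of_apply, Fin.sum_univ_two,
    Matrix.conjTranspose_apply, Real.cos_add, Real.cos_sub, Real.sin_add, Real.sin_sub]
  fin_cases i <;> fin_cases j <;> fin_cases k <;> fin_cases l <;>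
    simp [← Complex.cos_conj, ← Complex.sin_conj]
  · linear_combination (1 / 2) * (Complex.cos p ^ 2 - Complex.sin p ^ 2) * h2 - (1 / 2) * h1
  · linear_combination -((Complex.cos q * Complex.cos p + Complex.sin q * Complex.sin p) / 2) *
      Complex.I_sq
  · linear_combination -(1 / 2) * (Complex.cos p ^ 2 - Complex.sin p ^ 2) * h2 - (1 / 2) * h1
  · linear_combination ((Complex.cos q * Complex.cos p + Complex.sin q * Complex.sin p) / 2) *
      Complex.I_sq
  · linear_combination ((Complex.cos q * Complex.cos p + Complex.sin q * Complex.sin p) / 2) *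
      Complex.I_sq
  · linear_combination (1 / 2) * (Complex.sin q ^ 2 - Complex.cos q ^ 2) * h1 - (1 / 2) * h2
  · linear_combination -((Complex.cos q * Complex.cos p + Complex.sin q * Complex.sin p) / 2) *
      Complex.I_sq
  · linear_combination (1 / 2) * (Complex.cos q ^ 2 - Complex.sin q ^ 2) * h1 - (1 / 2) * h2

theorem traceB_qubitChoi (u v : ℝ) : traceB (qubitChoi u v) = 1 := by
  ext i j
  fin_cases i <;> fin_cases j <;>
    simp [traceB, qubitChoi, qubitMap]
  all_goals ring

/-- With `p = (u - v) / 2` and `q = (u + v) / 2`, the minor inequality reads `cos² p cos² q ≤ sin² p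
sin² q`, whereas `cos u cos v = cos² p cos² q - sin² p sin² q`. -/
theorem not_sepCone_qubitChoi {u v : ℝ} (h : 0 < Real.cos u * Real.cos v) :
    ¬ SepCone (qubitChoi u v) := by
  intro hs
  have := hs.norm_sq_le 0 1 0 1
  rw [qubitChoi_eq] at this
  obtain ⟨p, hp⟩ : ∃ p, (u - v) / 2 = p := ⟨_, rfl⟩
  obtain ⟨q, hq⟩ : ∃ q, (u + v) / 2 = q := ⟨_, rfl⟩
  obtain rfl : u = q + p := by linarith
  obtain rfl : v = q - p := by linarith
  simp only [Matrix.mul_apply, qubitRoot, hp, hq, Fin.sum_univ_two, Matrix.of_apply,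
    Matrix.conjTranspose_apply] at this
  simp at this
  rw [Real.cos_add, Real.cos_sub] at h
  have hc : ∀ x : ℝ, ‖Complex.cos x‖ ^ 2 = Real.cos x ^ 2 := fun x => by
    rw [← Complex.ofReal_cos, Complex.norm_real, Real.norm_eq_abs, sq_abs]
  have hs : ∀ x : ℝ, ‖Complex.sin x‖ * ‖Complex.sin x‖ = Real.sin x ^ 2 := fun x => by
    rw [← Complex.ofReal_sin, Complex.norm_real, Real.norm_eq_abs, abs_mul_abs_self, sq]
  rw [mul_pow, hc, hc, hs, hs] at this
  linarith

theorem continuous_qubitChoi : Continuous fun x : ℝ × ℝ => qubitChoi x.1 x.2 := by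
  have h : Continuous fun x : ℝ × ℝ => qubitRoot x.1 x.2 := by
    refine continuous_matrix fun p k => ?_
    obtain ⟨i, j⟩ := p
    fin_cases i <;> fin_cases j <;> simp only [qubitRoot, Matrix.of_apply] <;>
      simp <;> fun_prop
  simp only [qubitChoi_eq]
  exact h.matrix_mul h.matrix_conjTranspose

/-! ### The block states of the parametrization -/

section
variable {dA dB : ℕ}

theorem trace_projection (ψ : UnitSphere dB) :
    (Matrix.vecMulVec (fun i => ψ.1 i) (fun i => star (ψ.1 i))).trace = 1 := by
  have h := inner_self_eq_norm_sq_to_K (𝕜 := ℂ) ψ.1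
  have hn : ‖ψ.1‖ = 1 := by simp
  rw [EuclideanSpace.inner_eq_star_dotProduct, hn] at h
  rw [Matrix.trace_vecMulVec]
  refine Eq.trans ?_ (h.trans (by simp))
  rfl

theorem traceB_assemble (hA : 2 ≤ dA) {Q : Matrix (Fin 2 × Fin 2) (Fin 2 × Fin 2) ℂ}
    (hQ : traceB Q = 1) (V : Isometries dB) {U : Matrix (Fin dA) (Fin dA) ℂ}
    (hU : U ∈ Matrix.unitaryGroup (Fin dA) ℂ) (ψ : Rest dA → UnitSphere dB) :
    traceB (assemble Q V U ψ) = (1 / (dA : ℂ)) • 1 := by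
  have h1 : ∑ k : Fin 2, Matrix.single k k (1 : ℂ) = 1 := by
    simpa using (Matrix.matrix_eq_sum_single (1 : Matrix (Fin 2) (Fin 2) ℂ)).symm
  have h2 : ∑ k : Fin dA, Matrix.single k k (1 : ℂ) = 1 := by
    ext i j
    simp only [Matrix.sum_apply, Matrix.single_apply, Matrix.one_apply]
    by_cases h : i = j
    · simp [h]
    · rw [if_neg h]
      exact Finset.sum_eq_zero fun k _ => if_neg fun hk => h (hk.1.symm.trans hk.2)
  rw [assemble, traceB_smul, traceB_conj _ (by simp), traceB_add, traceB_conj _ V.2, hQ, traceB_sum]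
  simp only [traceB_kronecker, trace_projection, one_smul]
  rw [← h1, Matrix.mul_sum, Matrix.sum_mul]
  simp only [incl_mul_single_mul hA]
  rw [← sum_eq_sum_fin_two_add_sum_rest hA fun k => Matrix.single k k (1 : ℂ), h2, Matrix.mul_one]
  congr 1
  exact Matrix.mem_unitaryGroup_iff.mp hU

/-- One factorization gives both positivity and the rank bound: `Z` has two columns from the block
and one for each remaining basis vector. -/
theorem exists_assemble_eq (T : Matrix (Fin 2 × Fin 2) (Fin 2) ℂ) (V : Isometries dB)
    (U : Matrix (Fin dA) (Fin dA) ℂ) (ψ : Rest dA → UnitSphere dB) :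
    ∃ Z : Matrix (Fin dA × Fin dB) (Fin 2 ⊕ Rest dA) ℂ,
      assemble (T * Tᴴ) V U ψ = (1 / (dA : ℂ)) • (Z * Zᴴ) := by
  let P : Matrix (Fin dA × Fin dB) (Rest dA) ℂ :=
    Matrix.of fun p k => if p.1 = k.1 then (ψ k).1 p.2 else 0
  have hP : P * Pᴴ = ∑ k : Rest dA, Matrix.single k.1 k.1 (1 : ℂ) ⊗ₖ
      Matrix.vecMulVec (fun i => (ψ k).1 i) (fun i => star ((ψ k).1 i)) := by
    ext p q
    simp only [Matrix.mul_apply, Matrix.conjTranspose_apply, P, Matrix.of_apply, Matrix.sum_apply,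
      Matrix.kroneckerMap_apply, Matrix.single_apply, Matrix.vecMulVec_apply]
    refine Finset.sum_congr rfl fun k _ => ?_
    by_cases h1 : p.1 = k.1 <;> by_cases h2 : q.1 = k.1 <;> simp [h1, h2, Ne.symm]
  refine ⟨(U ⊗ₖ (1 : Matrix (Fin dB) (Fin dB) ℂ)) * Matrix.fromCols ((incl dA ⊗ₖ V.1) * T) P, ?_⟩
  rw [assemble, ← hP, Matrix.conjTranspose_mul, Matrix.conjTranspose_fromCols_eq_fromRows_conjTranspose,
    Matrix.mul_assoc _ (Matrix.fromCols _ _), ← Matrix.mul_assoc (Matrix.fromCols _ _),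
    Matrix.fromCols_mul_fromRows, Matrix.conjTranspose_mul]
  simp only [Matrix.mul_assoc]

theorem card_rest (hA : 2 ≤ dA) : Fintype.card (Fin 2 ⊕ Rest dA) = dA := by
  have h := sum_eq_sum_fin_two_add_sum_rest hA fun _ => 1
  simp only [Finset.sum_const, Finset.card_univ, Fintype.card_fin, smul_eq_mul, mul_one] at h
  rw [Fintype.card_sum, Fintype.card_fin]
  exact h.symm

theorem rank_assemble_le (hA : 2 ≤ dA) (T : Matrix (Fin 2 × Fin 2) (Fin 2) ℂ) (V : Isometries dB)
    (U : Matrix (Fin dA) (Fin dA) ℂ) (ψ : Rest dA → UnitSphere dB) :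
    (assemble (T * Tᴴ) V U ψ).rank ≤ dA := by
  obtain ⟨Z, hZ⟩ := exists_assemble_eq T V U ψ
  rw [hZ, ← Matrix.smul_mul]
  refine (Matrix.rank_mul_le_right _ _).trans ?_
  rw [Matrix.rank_conjTranspose]
  exact (Matrix.rank_le_card_width _).trans (card_rest hA).le

theorem posSemidef_assemble (T : Matrix (Fin 2 × Fin 2) (Fin 2) ℂ) (V : Isometries dB)
    (U : Matrix (Fin dA) (Fin dA) ℂ) (ψ : Rest dA → UnitSphere dB) :
    (assemble (T * Tᴴ) V U ψ).PosSemidef := by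
  obtain ⟨Z, hZ⟩ := exists_assemble_eq T V U ψ
  rw [hZ]
  refine (Matrix.posSemidef_self_mul_conjTranspose Z).smul ?_
  positivity

/-- The local compression by `(U * incl dA)ᴴ ⊗ Vᴴ` annihilates the rank one blocks and returns `Q`
up to the factor `1 / dA`. -/
theorem SepCone.of_assemble (hA : 2 ≤ dA) {Q : Matrix (Fin 2 × Fin 2) (Fin 2 × Fin 2) ℂ}
    {V : Isometries dB} {U : Matrix (Fin dA) (Fin dA) ℂ}
    (hU : U ∈ Matrix.unitaryGroup (Fin dA) ℂ) {ψ : Rest dA → UnitSphere dB}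
    (h : SepCone (assemble Q V U ψ)) : SepCone Q := by
  have hUU : Uᴴ * U = 1 := Matrix.mem_unitaryGroup_iff'.mp hU
  have h0 : ∀ k : Rest dA, (incl dA)ᴴ * Matrix.single k.1 k.1 (1 : ℂ) = 0 := by
    intro k
    ext i j
    have : k.1.val ≠ i.val := by have := k.2; omega
    rw [Matrix.mul_apply]
    refine Finset.sum_eq_zero fun l _ => ?_
    by_cases hl : k.1 = l
    · subst hl
      simp [incl, this]
    · simp [hl]
  have h1 : ((incl dA)ᴴ * Uᴴ) ⊗ₖ (V.1)ᴴ * (U ⊗ₖ (1 : Matrix (Fin dB) (Fin dB) ℂ)) =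
      (incl dA)ᴴ ⊗ₖ (V.1)ᴴ := by
    rw [← Matrix.mul_kronecker_mul, Matrix.mul_assoc, hUU, Matrix.mul_one, Matrix.mul_one]
  have h2 : (incl dA)ᴴ ⊗ₖ (V.1)ᴴ * (incl dA ⊗ₖ V.1) = 1 := by
    rw [← Matrix.mul_kronecker_mul, incl_conjTranspose_mul_incl hA, V.2, Matrix.one_kronecker_one]
  have h3 : (incl dA)ᴴ ⊗ₖ (V.1)ᴴ * (∑ k : Rest dA, Matrix.single k.1 k.1 (1 : ℂ) ⊗ₖ
      Matrix.vecMulVec (fun i => (ψ k).1 i) (fun i => star ((ψ k).1 i))) = 0 := by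
    rw [Matrix.mul_sum]
    refine Finset.sum_eq_zero fun k _ => ?_
    rw [← Matrix.mul_kronecker_mul, h0, Matrix.zero_kronecker]
  have h4 := h.conj ((incl dA)ᴴ * Uᴴ) (V.1)ᴴ
  have h5 : ((incl dA)ᴴ * Uᴴ) ⊗ₖ (V.1)ᴴ * assemble Q V U ψ * (((incl dA)ᴴ * Uᴴ) ⊗ₖ (V.1)ᴴ)ᴴ =
      (1 / (dA : ℂ)) • Q := by
    have h1' := congrArg Matrix.conjTranspose h1
    have h2' := congrArg Matrix.conjTranspose h2
    rw [Matrix.conjTranspose_mul] at h1' h2'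
    rw [assemble, Matrix.mul_smul, Matrix.smul_mul]
    congr 1
    rw [← Matrix.mul_assoc, ← Matrix.mul_assoc, h1, Matrix.mul_assoc _ _ (_)ᴴ, h1', Matrix.mul_add,
      h3, add_zero, ← Matrix.mul_assoc, ← Matrix.mul_assoc, h2, Matrix.one_mul, Matrix.mul_assoc, h2',
      Matrix.conjTranspose_one, Matrix.mul_one]
  rw [h5] at h4
  have h6 := h4.smul (t := dA) (by positivity)
  have hd : (dA : ℂ) ≠ 0 := by
    have : dA ≠ 0 := by omega
    exact_mod_cast this
  convert h6 using 1
  ext p q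
  simp [hd]

theorem sepCone_productMixture (U : Matrix (Fin dA) (Fin dA) ℂ) (ψ : Fin dA → UnitSphere dB) :
    SepCone (productMixture U ψ) := by
  have h : SepCone (∑ k, Matrix.single k k (1 : ℂ) ⊗ₖ
        Matrix.vecMulVec (fun i => (ψ k).1 i) (fun i => star ((ψ k).1 i))) := by
    refine ⟨Fin dA, inferInstance, fun k => Pi.single k 1, fun k i => (ψ k).1 i, ?_⟩
    refine Finset.sum_congr rfl fun k _ => ?_
    ext p q
    simp only [Matrix.kroneckerMap_apply, Matrix.single_apply, Matrix.vecMulVec_apply, prodVec,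
      Pi.star_apply, Pi.single_apply]
    by_cases h1 : p.1 = k <;> by_cases h2 : q.1 = k <;> simp [h1, h2, Ne.symm]
  have h' := (h.conj U (1 : Matrix (Fin dB) (Fin dB) ℂ)).smul (t := 1 / dA) (by positivity)
  convert h' using 1
  ext p q
  simp [productMixture]

theorem continuous_paramState : Continuous (paramState dA dB) := by
  have hU : Continuous fun x : Params dA dB =>
      x.2.2.1.1 ⊗ₖ (1 : Matrix (Fin dB) (Fin dB) ℂ) :=
    continuous_kronecker_one (by fun_prop)
  have hV : Continuous fun x : Params dA dB => incl dA ⊗ₖ x.2.1.1 := by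
    refine continuous_matrix fun p q => ?_
    simp only [Matrix.kroneckerMap_apply]
    have : Continuous fun x : Params dA dB => x.2.1.1 := by fun_prop
    exact continuous_const.mul (this.matrix_elem _ _)
  have hQ : Continuous fun x : Params dA dB => qubitChoi x.1.1 x.1.2 :=
    continuous_qubitChoi.comp continuous_fst
  unfold paramState assemble
  refine Continuous.const_smul ((hU.mul (((hV.matrix_mul hQ).matrix_mul hV.matrix_conjTranspose).add ?_)).mul
    hU.matrix_conjTranspose) (1 / (dA : ℂ))
  refine continuous_finsetSum _ fun k _ => continuous_kronecker_projection _ ?_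
  fun_prop

end

/-! ### The measure on states with maximally mixed marginal -/

instance instIsProbabilityMeasureHaarSU (d : ℕ) : IsProbabilityMeasure (haarSU d) :=
  ⟨by simpa [haarSU] using
    Measure.haarMeasure_self (K₀ := (⊤ : TopologicalSpace.PositiveCompacts (SU d)))⟩

instance instIsProbabilityMeasureSquare : IsProbabilityMeasure squareMeasure := by
  have h : volume (Set.Icc 0 (Real.pi / 2) ×ˢ Set.Icc 0 (Real.pi / 2) : Set (ℝ × ℝ)) =
      ENNReal.ofReal (Real.pi / 2) * ENNReal.ofReal (Real.pi / 2) := by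
    rw [Measure.volume_eq_prod, Measure.prod_prod, Real.volume_Icc, sub_zero]
  refine cond_isProbabilityMeasure_of_finite ?_ ?_ <;> rw [h]
  · simp [Real.pi_pos]
  · exact ENNReal.mul_ne_top ENNReal.ofReal_ne_top ENNReal.ofReal_ne_top

/-- On the square a cosine vanishes only on the edges `u = π/2` and `v = π/2`, which are null. -/
theorem ae_squareMeasure_cos_mul_cos_pos :
    ∀ᵐ x ∂squareMeasure, 0 < Real.cos x.1 * Real.cos x.2 := by
  have h1 : ∀ᵐ x : ℝ × ℝ, x.1 ≠ Real.pi / 2 :=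
    Measure.quasiMeasurePreserving_fst.ae (Measure.ae_ne volume (Real.pi / 2))
  have h2 : ∀ᵐ x : ℝ × ℝ, x.2 ≠ Real.pi / 2 :=
    Measure.quasiMeasurePreserving_snd.ae (Measure.ae_ne volume (Real.pi / 2))
  have hm : MeasurableSet (Set.Icc 0 (Real.pi / 2) ×ˢ Set.Icc 0 (Real.pi / 2) : Set (ℝ × ℝ)) :=
    measurableSet_Icc.prod measurableSet_Icc
  filter_upwards [cond_absolutelyContinuous.ae_le h1, cond_absolutelyContinuous.ae_le h2,
    ae_cond_mem hm] with x hx1 hx2 hx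
  have hpi := Real.pi_pos
  refine mul_pos (Real.cos_pos_of_mem_Ioo ⟨?_, lt_of_le_of_ne hx.1.2 hx1⟩)
    (Real.cos_pos_of_mem_Ioo ⟨?_, lt_of_le_of_ne hx.2.2 hx2⟩)
  · linarith [hx.1.1]
  · linarith [hx.2.1]

section
variable {dA dB : ℕ} (v : Measure (Isometries dB)) (n : Measure (UnitSphere dB))

theorem measurable_paramState : Measurable (paramState dA dB) :=
  continuous_paramState.measurable

theorem SU.mem_unitaryGroup {d : ℕ} (U : SU d) : U.1 ∈ Matrix.unitaryGroup (Fin d) ℂ :=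
  (Matrix.mem_specialUnitaryGroup_iff.mp U.2).1

theorem trace_eq_one_of_traceB_eq (hA : 2 ≤ dA)
    {γ : Matrix (Fin dA × Fin dB) (Fin dA × Fin dB) ℂ}
    (h : traceB γ = (1 / (dA : ℂ)) • 1) : γ.trace = 1 := by
  have hd : (dA : ℂ) ≠ 0 := by
    have : dA ≠ 0 := by omega
    exact_mod_cast this
  rw [← trace_traceB, h]
  simp [hd]

/-- Lower semicontinuity of the rank. With the two closedness results that follow, it makes the
state conditions Borel, so that they can be checked before the push-forward. -/
theorem isClosed_setOf_rank_le {m : Type} [Fintype m] [DecidableEq m] (r : ℕ) :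
    IsClosed {γ : Matrix m m ℂ | γ.rank ≤ r} := by
  let F : Matrix m m ℂ →ₗ[ℂ] ((m → ℂ) →L[ℂ] (m → ℂ)) :=
    LinearMap.toContinuousLinearMap.toLinearMap ∘ₗ Matrix.toLin'.toLinearMap
  have hF : Continuous F := F.continuous_of_finiteDimensional
  have hset : {γ : Matrix m m ℂ | γ.rank ≤ r}ᶜ =
      F ⁻¹' {f | ((r + 1 : ℕ) : Cardinal) ≤ LinearMap.rank (f : (m → ℂ) →ₗ[ℂ] (m → ℂ))} := by
    ext γ
    have : LinearMap.rank (F γ : (m → ℂ) →ₗ[ℂ] (m → ℂ)) = (γ.rank : Cardinal) :=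
      (Module.finrank_eq_rank ℂ (LinearMap.range γ.mulVecLin)).symm
    simp only [Set.mem_compl_iff, Set.mem_ofPred_eq, Set.mem_preimage, this, not_le]
    rw [Nat.cast_le, Nat.succ_le_iff]
  rw [← isOpen_compl_iff, hset]
  exact (isOpen_setOfPred_nat_le_rank (r + 1)).preimage hF

theorem isClosed_setOf_posSemidef {m : Type} [Fintype m] :
    IsClosed {γ : Matrix m m ℂ | γ.PosSemidef} := by
  simp only [Matrix.posSemidef_iff_dotProduct_mulVec, Matrix.IsHermitian, Set.ofPred_and,
    Set.ofPred_forall]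
  refine IsClosed.inter (isClosed_eq continuous_id.matrix_conjTranspose continuous_id)
    (isClosed_iInter fun x => ?_)
  exact isClosed_Ici.preimage (continuous_const.dotProduct (continuous_id.matrix_mulVec continuous_const))

theorem continuous_traceB {m n : Type} [Fintype n] :
    Continuous (traceB : Matrix (m × n) (m × n) ℂ → Matrix m m ℂ) := by
  refine continuous_matrix fun j k => ?_
  simp only [traceB, Matrix.of_apply]
  exact continuous_finsetSum _ fun i _ => continuous_id.matrix_elem _ _

theorem isExtension_channelMeasure (hA : 2 ≤ dA) :
    IsExtension dA dB v n (channelMeasure dA dB v n) := by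
  refine ⟨?_, fun _ _ _ => rfl⟩
  have h : ∀ x : Params dA dB, IsDensity (paramState dA dB x) ∧ (paramState dA dB x).rank ≤ dA ∧
      traceB (paramState dA dB x) = (1 / (dA : ℂ)) • 1 := by
    intro x
    have ht : traceB (paramState dA dB x) = (1 / (dA : ℂ)) • 1 :=
      traceB_assemble hA (traceB_qubitChoi _ _) _ (SU.mem_unitaryGroup _) _
    refine ⟨⟨?_, trace_eq_one_of_traceB_eq hA ht⟩, ?_, ht⟩
    · rw [paramState, qubitChoi_eq]
      exact posSemidef_assemble _ _ _ _
    · rw [paramState, qubitChoi_eq]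
      exact rank_assemble_le hA _ _ _ _
  have hclosed : IsClosed {γ : Matrix (Fin dA × Fin dB) (Fin dA × Fin dB) ℂ |
      IsDensity γ ∧ γ.rank ≤ dA ∧ traceB γ = (1 / (dA : ℂ)) • 1} :=
    (isClosed_setOf_posSemidef.inter
      (isClosed_eq continuous_id.matrix_trace continuous_const)).inter
      ((isClosed_setOf_rank_le dA).inter (isClosed_eq continuous_traceB continuous_const))
  rw [channelMeasure, ae_map_iff measurable_paramState.aemeasurable hclosed.measurableSet]
  exact Filter.Eventually.of_forall h

theorem channelMeasure_productMixtures (hA : 2 ≤ dA) :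
    channelMeasure dA dB v n (productMixtures dA dB) = 0 := by
  rw [channelMeasure, Measure.map_apply measurable_paramState
    (isCompact_productMixtures dA dB).measurableSet]
  have h : ∀ᵐ x ∂paramMeasure dA dB v n, 0 < Real.cos x.1.1 * Real.cos x.1.2 :=
    Measure.quasiMeasurePreserving_fst.ae ae_squareMeasure_cos_mul_cos_pos
  refine measure_mono_null ?_ (ae_iff.mp h)
  rintro x ⟨⟨U, ψ⟩, -, hx⟩ hpos
  refine not_sepCone_qubitChoi hpos (SepCone.of_assemble hA (SU.mem_unitaryGroup x.2.2.1)
    (V := x.2.1) (ψ := x.2.2.2) ?_)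
  have hs : productMixture U ψ = paramState dA dB x := hx
  have h' := sepCone_productMixture U ψ
  rwa [hs] at h'

variable [IsProbabilityMeasure v] [IsProbabilityMeasure n]

instance instIsProbabilityMeasureParam : IsProbabilityMeasure (paramMeasure dA dB v n) := by
  unfold paramMeasure
  infer_instance

instance instIsProbabilityMeasureChannel : IsProbabilityMeasure (channelMeasure dA dB v n) :=
  Measure.isProbabilityMeasure_map measurable_paramState.aemeasurable

end

/-! ### The measure on density matrices -/

section
variable {d : ℕ}

theorem continuous_completeSpectrum (i : Fin d) :
    Continuous fun x : Fin (d - 1) → ℝ => completeSpectrum d x i := by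
  unfold completeSpectrum
  split <;> fun_prop

theorem sum_completeSpectrum (hd : 2 ≤ d) (x : Fin (d - 1) → ℝ) :
    ∑ i, completeSpectrum d x i = 1 := by
  obtain ⟨c, rfl⟩ : ∃ c, d = c + 1 := ⟨d - 1, by omega⟩
  rw [Fin.sum_univ_castSucc]
  have h : ∀ i : Fin c, completeSpectrum (c + 1) x i.castSucc = x i := by
    intro i
    simp [completeSpectrum]
  have h2 : completeSpectrum (c + 1) x (Fin.last c) = 1 - ∑ j, x j := by
    simp [completeSpectrum]
  rw [h2]
  simp only [h]
  exact add_sub_cancel _ _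

theorem isClosed_spectralSimplex : IsClosed (spectralSimplex d) := by
  have : spectralSimplex d = (⋂ i, {x | 0 ≤ completeSpectrum d x i}) ∩
      ⋂ i, ⋂ j, ⋂ (_ : i ≤ j), {x | completeSpectrum d x i ≤ completeSpectrum d x j} := by
    ext x
    simp [spectralSimplex, Monotone]
  rw [this]
  refine IsClosed.inter (isClosed_iInter fun i => ?_) (isClosed_iInter fun i => isClosed_iInter fun j =>
    isClosed_iInter fun _ => ?_)
  · exact isClosed_le continuous_const (continuous_completeSpectrum i)
  · exact isClosed_le (continuous_completeSpectrum i) (continuous_completeSpectrum j)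

theorem spectralSimplex_subset_Icc (hd : 2 ≤ d) :
    spectralSimplex d ⊆ Set.Icc 0 1 := by
  intro x hx
  have h : ∀ i : Fin (d - 1), completeSpectrum d x ⟨i.1, by omega⟩ = x i := by
    intro i
    simp [completeSpectrum]
  refine ⟨fun i => ?_, fun i => ?_⟩
  · rw [← h i]
    exact hx.1 _
  · rw [← h i, Pi.one_apply, ← sum_completeSpectrum hd x]
    exact Finset.single_le_sum (f := completeSpectrum d x) (fun j _ => hx.1 j) (Finset.mem_univ _)

/-- The strict inequalities cut out an open subset, nonempty because it contains the spectrum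
proportional to `1, 2, …, d`. -/
theorem volume_spectralSimplex_ne_zero (hd : 2 ≤ d) : volume (spectralSimplex d) ≠ 0 := by
  let S : Set (Fin (d - 1) → ℝ) := (⋂ i, {x | 0 < completeSpectrum d x i}) ∩
      ⋂ i, ⋂ j, ⋂ (_ : i < j), {x | completeSpectrum d x i < completeSpectrum d x j}
  have hS : IsOpen S := by
    refine IsOpen.inter (isOpen_iInter_of_finite fun i => ?_) (isOpen_iInter_of_finite fun i =>
      isOpen_iInter_of_finite fun j => isOpen_iInter_of_finite fun _ => ?_)
    · exact isOpen_lt continuous_const (continuous_completeSpectrum i)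
    · exact isOpen_lt (continuous_completeSpectrum i) (continuous_completeSpectrum j)
  have hsub : S ⊆ spectralSimplex d := by
    rintro x ⟨h1, h2⟩
    simp only [Set.mem_iInter, Set.mem_ofPred_eq] at h1 h2
    refine ⟨fun i => (h1 i).le, fun i j hij => ?_⟩
    rcases hij.eq_or_lt with rfl | h
    · exact le_rfl
    · exact (h2 i j h).le
  have hne : S.Nonempty := by
    let s : ℝ := ∑ i : Fin d, ((i.1 : ℝ) + 1)
    have hs : 0 < s := by
      have : Nonempty (Fin d) := ⟨⟨0, by omega⟩⟩
      exact Finset.sum_pos (fun i _ => by positivity) Finset.univ_nonempty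
    have hval : ∀ i : Fin d, completeSpectrum d (fun i => ((i.1 : ℝ) + 1) / s) i =
        ((i.1 : ℝ) + 1) / s := by
      have key : ∀ i : Fin d, i.1 < d - 1 → completeSpectrum d (fun i => ((i.1 : ℝ) + 1) / s) i =
        ((i.1 : ℝ) + 1) / s := by
        intro i hi
        simp [completeSpectrum, hi]
      intro i
      by_cases hi : i.1 < d - 1
      · exact key i hi
      -- The last entry is forced, since both vectors sum to one and agree elsewhere.
      · have h1 := sum_completeSpectrum hd (fun i => ((i.1 : ℝ) + 1) / s)
        have h2 : ∑ i : Fin d, ((i.1 : ℝ) + 1) / s = 1 := by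
          rw [← Finset.sum_div]
          exact div_self hs.ne'
        rw [← Finset.add_sum_erase _ _ (Finset.mem_univ i)] at h1 h2
        rw [Finset.sum_congr rfl fun j hj => key j ?_] at h1
        · linarith
        · have := Finset.ne_of_mem_erase hj
          have hj' : j.1 ≠ i.1 := fun h => this (Fin.ext h)
          omega
    refine ⟨fun i => ((i.1 : ℝ) + 1) / s, ?_⟩
    simp only [S, Set.mem_inter_iff, Set.mem_iInter, Set.mem_ofPred_eq, hval]
    refine ⟨fun i => by positivity, fun i j hij => ?_⟩
    have : (i.1 : ℝ) < j.1 := by exact_mod_cast hij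
    gcongr
  exact ((hS.measure_pos volume hne).trans_le (measure_mono hsub)).ne'

theorem isProbabilityMeasure_cond_spectralSimplex (hd : 2 ≤ d) :
    IsProbabilityMeasure (cond volume (spectralSimplex d)) := by
  refine cond_isProbabilityMeasure_of_finite (volume_spectralSimplex_ne_zero hd) ?_
  refine ((measure_mono (spectralSimplex_subset_Icc hd)).trans_lt ?_).ne
  exact isCompact_Icc.measure_lt_top

theorem measurable_spectralState : Measurable (spectralState d) := by
  have h : Continuous (spectralState d) := by
    unfold spectralState
    have hU : Continuous fun p : (Fin (d - 1) → ℝ) × SU d => p.2.1 := by fun_prop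
    refine (hU.mul ?_).mul hU.matrix_conjTranspose
    refine Continuous.matrix_diagonal (continuous_pi fun i => ?_)
    exact Complex.continuous_ofReal.comp ((continuous_completeSpectrum i).comp continuous_fst)
  exact h.measurable

theorem isProbabilityMeasure_spectralMeasure (hd : 2 ≤ d) :
    IsProbabilityMeasure (spectralMeasure d) := by
  have := isProbabilityMeasure_cond_spectralSimplex hd
  exact Measure.isProbabilityMeasure_map measurable_spectralState.aemeasurable

/-- For `d ≥ 2` the smallest eigenvalue is a free coordinate, hence almost surely nonzero;
monotonicity passes positivity on to the others. -/
theorem ae_cond_spectralSimplex_pos (hd : 2 ≤ d) :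
    ∀ᵐ x ∂(cond volume (spectralSimplex d)), ∀ i, 0 < completeSpectrum d x i := by
  have h0 : ∀ᵐ x : Fin (d - 1) → ℝ, x ⟨0, by omega⟩ ≠ 0 :=
    Measure.ae_eval_ne (fun _ : Fin (d - 1) => (volume : Measure ℝ)) _ 0
  filter_upwards [cond_absolutelyContinuous.ae_le h0,
    ae_cond_mem isClosed_spectralSimplex.measurableSet] with x hx hmem i
  have h1 : completeSpectrum d x ⟨0, by omega⟩ = x ⟨0, by omega⟩ := by
    have : 0 < d - 1 := by omega
    simp [completeSpectrum, this]
  have h2 : 0 < completeSpectrum d x ⟨0, by omega⟩ :=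
    lt_of_le_of_ne (hmem.1 _) (by rw [h1]; exact hx.symm)
  exact h2.trans_le (hmem.2 (Fin.le_def.mpr (Nat.zero_le _)))

theorem spectralState_posDef {x : Fin (d - 1) → ℝ} (hx : ∀ i, 0 < completeSpectrum d x i)
    (U : SU d) : (spectralState d (x, U)).PosDef := by
  have hU : U.1 * (U.1)ᴴ = 1 := Matrix.mem_unitaryGroup_iff.mp (SU.mem_unitaryGroup U)
  have hD : (Matrix.diagonal fun i => (completeSpectrum d x i : ℂ)).PosDef :=
    Matrix.PosDef.diagonal fun i => by exact_mod_cast hx i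
  refine hD.mul_mul_conjTranspose_same (B := U.1) ?_
  intro a b hab
  have := congrArg (fun w => w ᵥ* (U.1)ᴴ) hab
  simpa [Matrix.vecMul_vecMul, hU] using this

theorem trace_spectralState (hd : 2 ≤ d) (x : Fin (d - 1) → ℝ) (U : SU d) :
    (spectralState d (x, U)).trace = 1 := by
  have hU : (U.1)ᴴ * U.1 = 1 := Matrix.mem_unitaryGroup_iff'.mp (SU.mem_unitaryGroup U)
  rw [spectralState, Matrix.trace_mul_comm, ← Matrix.mul_assoc, hU, Matrix.one_mul,
    Matrix.trace_diagonal, ← Complex.ofReal_sum, sum_completeSpectrum hd, Complex.ofReal_one]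

theorem ae_spectralMeasure (hd : 2 ≤ d) :
    ∀ᵐ ρ ∂(spectralMeasure d), ρ.PosSemidef ∧ ρ.trace = 1 ∧ ρ.det ≠ 0 := by
  have := isProbabilityMeasure_cond_spectralSimplex hd
  have hm : MeasurableSet {ρ : Matrix (Fin d) (Fin d) ℂ |
      ρ.PosSemidef ∧ ρ.trace = 1 ∧ ρ.det ≠ 0} :=
    isClosed_setOf_posSemidef.measurableSet.inter
      ((isClosed_eq continuous_id.matrix_trace continuous_const).measurableSet.inter
        (isOpen_ne_fun continuous_id.matrix_det continuous_const).measurableSet)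
  rw [spectralMeasure, ae_map_iff measurable_spectralState.aemeasurable hm]
  filter_upwards [Measure.quasiMeasurePreserving_fst.ae (ae_cond_spectralSimplex_pos hd)] with x hx
  have h := spectralState_posDef hx x.2
  exact ⟨h.posSemidef, trace_spectralState hd _ _, h.det_pos.ne'⟩

end

/-! ### Local filtering -/

section
variable {dA dB : ℕ}

theorem rank_withMarginal_le {r : ℕ}
    {p : Matrix (Fin dA × Fin dB) (Fin dA × Fin dB) ℂ × Matrix (Fin dA) (Fin dA) ℂ}
    (h : p.1.rank ≤ r) : (withMarginal dA dB p).rank ≤ r :=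
  (Matrix.rank_mul_le_left _ _).trans ((Matrix.rank_mul_le_right _ _).trans h)

theorem exists_withMarginal_eq {γ : Matrix (Fin dA × Fin dB) (Fin dA × Fin dB) ℂ}
    {ρ : Matrix (Fin dA) (Fin dA) ℂ} (hρ : ρ.PosSemidef) :
    ∃ S : Matrix (Fin dA) (Fin dA) ℂ, S * Sᴴ = (dA : ℂ) • ρ ∧
      withMarginal dA dB (γ, ρ) =
        (S ⊗ₖ (1 : Matrix (Fin dB) (Fin dB) ℂ)) * γ * (S ⊗ₖ (1 : Matrix (Fin dB) (Fin dB) ℂ))ᴴ := by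
  have h0 : (0 : Matrix (Fin dA) (Fin dA) ℂ) ≤ (dA : ℂ) • ρ :=
    (hρ.smul (by positivity)).nonneg
  have hS : (CFC.sqrt ((dA : ℂ) • ρ))ᴴ = CFC.sqrt ((dA : ℂ) • ρ) :=
    (Matrix.nonneg_iff_posSemidef.mp (CFC.sqrt_nonneg ((dA : ℂ) • ρ))).isHermitian
  refine ⟨CFC.sqrt ((dA : ℂ) • ρ), ?_, ?_⟩
  · rw [hS]
    exact CFC.sqrt_mul_sqrt_self _ h0
  · rw [withMarginal, Matrix.conjTranspose_kronecker, hS, Matrix.conjTranspose_one]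

theorem traceB_withMarginal (hA : 2 ≤ dA) {γ : Matrix (Fin dA × Fin dB) (Fin dA × Fin dB) ℂ}
    {ρ : Matrix (Fin dA) (Fin dA) ℂ} (hρ : ρ.PosSemidef)
    (hγ : traceB γ = (1 / (dA : ℂ)) • 1) : traceB (withMarginal dA dB (γ, ρ)) = ρ := by
  have hd : (dA : ℂ) ≠ 0 := by
    have : dA ≠ 0 := by omega
    exact_mod_cast this
  obtain ⟨S, hS, h⟩ := exists_withMarginal_eq (γ := γ) hρ
  rw [h, traceB_conj _ (by simp), hγ, Matrix.mul_smul, Matrix.smul_mul, Matrix.mul_one, hS,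
    smul_smul, one_div_mul_cancel hd, one_smul]

/-- An invertible `ρ` has an invertible square root, so the filter is undone by the local map `S⁻¹ ⊗
1`, which preserves the cone. -/
theorem SepCone.of_withMarginal (hA : 2 ≤ dA)
    {γ : Matrix (Fin dA × Fin dB) (Fin dA × Fin dB) ℂ}
    {ρ : Matrix (Fin dA) (Fin dA) ℂ} (hρ : ρ.PosSemidef) (hdet : ρ.det ≠ 0)
    (h : SepCone (withMarginal dA dB (γ, ρ))) : SepCone γ := by
  have hd : (dA : ℂ) ≠ 0 := by
    have : dA ≠ 0 := by omega
    exact_mod_cast this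
  obtain ⟨S, hS, hw⟩ := exists_withMarginal_eq (γ := γ) hρ
  have hSdet : IsUnit S.det := by
    have := congrArg Matrix.det hS
    rw [Matrix.det_mul, Matrix.det_smul] at this
    refine isUnit_iff_ne_zero.mpr fun h0 => ?_
    rw [h0, zero_mul] at this
    exact mul_ne_zero (pow_ne_zero _ hd) hdet this.symm
  have h1 : S⁻¹ ⊗ₖ (1 : Matrix (Fin dB) (Fin dB) ℂ) * (S ⊗ₖ (1 : Matrix (Fin dB) (Fin dB) ℂ)) =
      1 := by
    rw [← Matrix.mul_kronecker_mul, Matrix.nonsing_inv_mul _ hSdet, Matrix.one_mul,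
      Matrix.one_kronecker_one]
  have h2 := h.conj S⁻¹ (1 : Matrix (Fin dB) (Fin dB) ℂ)
  rwa [hw, ← Matrix.mul_assoc, ← Matrix.mul_assoc, h1, Matrix.one_mul, Matrix.mul_assoc,
    ← Matrix.conjTranspose_mul, h1, Matrix.conjTranspose_one, Matrix.mul_one] at h2

theorem isDensity_withMarginal (hA : 2 ≤ dA)
    {γ : Matrix (Fin dA × Fin dB) (Fin dA × Fin dB) ℂ}
    {ρ : Matrix (Fin dA) (Fin dA) ℂ} (hρ : ρ.PosSemidef) (htr : ρ.trace = 1)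
    (hpos : γ.PosSemidef) (hγ : traceB γ = (1 / (dA : ℂ)) • 1) :
    IsDensity (withMarginal dA dB (γ, ρ)) := by
  refine ⟨?_, ?_⟩
  · obtain ⟨S, hS, hw⟩ := exists_withMarginal_eq (γ := γ) hρ
    rw [hw]
    exact hpos.mul_mul_conjTranspose_same _
  · rw [← trace_traceB, traceB_withMarginal hA hρ hγ, htr]

theorem SepCone.mem_productMixtures (hA : 2 ≤ dA) (hB : 2 ≤ dB)
    {γ : Matrix (Fin dA × Fin dB) (Fin dA × Fin dB) ℂ} (h : SepCone γ)
    (hγ : traceB γ = (1 / (dA : ℂ)) • 1) (hrank : γ.rank ≤ dA) : γ ∈ productMixtures dA dB := by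
  have hd : (dA : ℂ) ≠ 0 := by
    have : dA ≠ 0 := by omega
    exact_mod_cast this
  have : Nonempty (Fin dB) := ⟨⟨0, by omega⟩⟩
  have hs : SepCone ((dA : ℂ) • γ) := by
    convert h.smul (t := dA) (by positivity) using 1
    ext p q
    simp
  have ht : traceB ((dA : ℂ) • γ) = 1 := by
    rw [traceB_smul, hγ, smul_smul, mul_one_div_cancel hd, one_smul]
  -- The scalar is moved into a right factor `(dA : ℂ) • 1`, so the rank cannot increase.
  have hr : ((dA : ℂ) • γ).rank ≤ Fintype.card (Fin dA) := by
    rw [← Matrix.mul_one γ, ← Matrix.smul_mul, Matrix.smul_mul, ← Matrix.mul_smul,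
      Fintype.card_fin]
    exact (Matrix.rank_mul_le_left _ _).trans hrank
  obtain ⟨U, hU, ψ, hψ, heq⟩ := hs.exists_unitary ht hr
  refine ⟨(U, fun k => ⟨ψ k, by simpa using hψ k⟩), ⟨hU, Set.mem_univ _⟩, ?_⟩
  change productMixture _ _ = γ
  rw [productMixture]
  simp only
  rw [← heq, smul_smul, one_div_mul_cancel hd, one_smul]

end

end RankEntanglement

/-! ### Almost sure entanglement -/

theorem theorem9 (dA dB : ℕ) (hB : 2 ≤ dB) (hAB : dB ≤ dA)
    (v : Measure (Isometries dB)) [IsProbabilityMeasure v]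
    (hv : ∀ W : SU dB, v.map (leftTranslate W) = v)
    (n : Measure (UnitSphere dB)) [IsProbabilityMeasure n] :
    (IsProbabilityMeasure (channelMeasure dA dB v n) ∧
      IsExtension dA dB v n (channelMeasure dA dB v n) ∧
      IsProbabilityMeasure (spectralMeasure dA)) ∧
    ∀ ω : Measure (Matrix (Fin dA × Fin dB) (Fin dA × Fin dB) ℂ), SFinite ω →
      IsExtension dA dB v n ω →
      ∀ᵐ p ∂(ω.prod (spectralMeasure dA)),
        (withMarginal dA dB p).rank ≤ dA ∧ traceB (withMarginal dA dB p) = p.2 ∧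
          IsEntangled (withMarginal dA dB p) := by
  have hA : 2 ≤ dA := hB.trans hAB
  have hη := isProbabilityMeasure_spectralMeasure hA
  refine ⟨⟨inferInstance, isExtension_channelMeasure v n hA, hη⟩, fun ω _ hω => ?_⟩
  -- An extension is prescribed only on Borel sets of block states, but all separable candidates lie
  -- in one such set, and `μ` does not charge it.
  have hsep : ∀ᵐ γ ∂ω, γ ∉ productMixtures dA dB := by
    refine measure_eq_zero_iff_ae_notMem.mp ?_
    rw [hω.2 _ (productMixtures_subset_blockStates hB hA)
      (isCompact_productMixtures dA dB).measurableSet]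
    exact channelMeasure_productMixtures v n hA
  filter_upwards [Measure.quasiMeasurePreserving_fst.ae hω.1,
    Measure.quasiMeasurePreserving_fst.ae hsep,
    Measure.quasiMeasurePreserving_snd.ae (ae_spectralMeasure hA)] with p h1 h2 h3
  obtain ⟨γ, ρ⟩ := p
  refine ⟨rank_withMarginal_le h1.2.1, traceB_withMarginal hA h3.1 h1.2.2,
    isDensity_withMarginal hA h3.1 h3.2.1 h1.1.1 h1.2.2, fun hs => h2 ?_⟩
  exact (hs.sepCone.of_withMarginal hA h3.1 h3.2.2).mem_productMixtures hA hB h1.2.2 h1.2.1
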